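/- Let $K$ be a field of characteristic $0$, let $G$ be a reductive affine algebraic group over $K$ (given by its group of $K$-points with its finitely generated algebra of regular functions; reductive means that every finite dimensional rational representation is completely reducible), and let $V$ be a finite dimensional rational representation of $G$. Let $P$ be a homogeneous polynomial functor of degree $k\ge 0$, that is, a functor from finite dimensional $K$-vector spaces to finite dimensional $K$-vector spaces such that for all $U,W$ the map $\mathrm{Hom}(U,W)\to\mathrm{Hom}(P(U),P(W))$, $f\mapsto P(f)$, is homogeneous polynomial of degree $k$. Then $G$ acts on $P(V)$ by functoriality. Let $\Lambda$ be the ring of symmetric functions over $K$ (symmetric formal power series of bounded degree in $x_1,x_2,\dots$), with complete homogeneous symmetric functions $h_r$, power sums $p_n$, the scalar product with $\langle p_\lambda,p_\mu\rangle=z_\lambda\delta_{\lambda\mu}$, where $z_\lambda=\prod_n n^{m_n}m_n!$ for $\lambda$ with $m_n$ parts equal to $n$, and plethysm $f[g]$, for which $f\mapsto f[g]$ is the $K$-algebra homomorphism with $p_n[g]=g(x_1^n,x_2^n,\dots)$. For $n\ge 0$ let $$I_n(V)=\frac1{n!}\sum_{\pi\in\mathfrak S_n}\mathrm{Tr}\big(\pi\,|\,(V^{\otimes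 n})^G\big)\,p_{\lambda(\pi)}\in\Lambda$$ be the Frobenius character of the $\mathfrak S_n$-representation $(V^{\otimes n})^G$, where $\mathfrak S_n$ permutes the tensor factors and $\lambda(\pi)$ is the cycle type of $\pi$. Then there is a unique symmetric function $\mathrm{ch}\,P\in\Lambda$ (the character of $P$) such that $\mathrm{ch}\,P(a_1,\dots,a_n,0,0,\dots)=\mathrm{Tr}\,P(A)$ for every $n$ and every invertible diagonal matrix $A=\mathrm{diag}(a_1,\dots,a_n)$. For every $r\ge 0$ the space $K[P(V)]^G_r$ of $G$-invariant homogeneous polynomials of degree $r$ on $P(V)$ is finite dimensional, and $$\dim K[P(V)]^G_r=\big\langle h_r[\mathrm{ch}\,P],\,I_{rk}(V)\big\rangle .$$ Consequently the Hilbert series of the graded ring $K[P(V)]^G$ of $G$-invariant polynomials on $P(V)$ is $$\sum_{r\ge 0}\dim K[P(V)]^G_r\,t^r=\sum_{r\ge 0}\big\langle h_r[\mathrm{ch}\,P],\,I_{rk}(V)\big\rangle\,t^r .$$ -/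

import Mathlib

open CategoryTheory

universe u v

noncomputable section

namespace TensorInvariants

/-! ### Symmetric functions -/

/-- The ring `Λ` of symmetric functions with coefficients in `K`: the formal power series of bounded
degree in the variables `x₀, x₁, x₂, …` which are invariant under all permutations of the
variables. -/
def SymFun (K : Type u) [Field K] : Subalgebra K (MvPowerSeries ℕ K) where
  carrier := {f | (∀ e : Equiv.Perm ℕ, MvPowerSeries.rename e f = f) ∧
    ∃ N : ℕ, ∀ d : ℕ →₀ ℕ, N < d.degree → MvPowerSeries.coeff d f = 0}
  mul_mem' := by
    rintro f g ⟨hf, N, hN⟩ ⟨hg, M, hM⟩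
    refine ⟨fun e => by rw [map_mul, hf, hg], N + M, fun d hd => ?_⟩
    classical
    rw [MvPowerSeries.coeff_mul]
    refine Finset.sum_eq_zero fun p hp => ?_
    rw [Finset.HasAntidiagonal.mem_antidiagonal] at hp
    have h : p.1.degree + p.2.degree = d.degree := by rw [← hp, map_add]
    rcases lt_or_ge N p.1.degree with h1 | h1
    · rw [hN _ h1, zero_mul]
    · rw [hM _ (by omega), mul_zero]
  add_mem' := by
    rintro f g ⟨hf, N, hN⟩ ⟨hg, M, hM⟩
    refine ⟨fun e => by rw [map_add, hf, hg], max N M, fun d hd => ?_⟩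
    rw [map_add, hN _ (lt_of_le_of_lt (le_max_left _ _) hd),
      hM _ (lt_of_le_of_lt (le_max_right _ _) hd), add_zero]
  algebraMap_mem' c := by
    refine ⟨fun e => AlgHom.commutes _ c, 0, fun d hd => ?_⟩
    classical
    have hd0 : d ≠ 0 := by
      rintro rfl
      simp at hd
    rw [MvPowerSeries.algebraMap_apply, MvPowerSeries.coeff_C, if_neg hd0]

variable {K : Type u} [Field K]

/-- A power series whose coefficients are invariant under permutations of the variables is fixed by
all renamings of the variables. -/
theorem rename_eq_self {f : MvPowerSeries ℕ K}
    (h : ∀ (e : Equiv.Perm ℕ) (d : ℕ →₀ ℕ), MvPowerSeries.coeff (d.embDomain e.toEmbedding) f =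
      MvPowerSeries.coeff d f) (e : Equiv.Perm ℕ) : MvPowerSeries.rename e f = f := by
  ext d
  obtain ⟨d, rfl⟩ : ∃ d' : ℕ →₀ ℕ, d'.embDomain e.toEmbedding = d :=
    ⟨d.embDomain e.symm.toEmbedding, by
      ext i
      obtain ⟨j, rfl⟩ := e.surjective i
      have h1 := Finsupp.embDomain_apply_self e.toEmbedding (d.embDomain e.symm.toEmbedding) j
      have h2 := Finsupp.embDomain_apply_self e.symm.toEmbedding d (e j)
      simp only [Equiv.coe_toEmbedding, Equiv.symm_apply_apply] at h1 h2
      rw [h1, h2]⟩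
  exact (MvPowerSeries.coeff_embDomain_rename e.toEmbedding f d).trans (h e d).symm

/-- The degree of a monomial does not change when its variables are permuted. -/
theorem degree_embDomain (e : Equiv.Perm ℕ) (d : ℕ →₀ ℕ) :
    (d.embDomain e.toEmbedding).degree = d.degree := by
  rw [Finsupp.degree_apply, Finsupp.degree_apply, Finsupp.support_embDomain, Finset.sum_map]
  exact Finset.sum_congr rfl fun i _ => Finsupp.embDomain_apply_self _ _ _

open Classical in
/-- The complete homogeneous symmetric function `h_r`, the sum of all monomials of degree `r`. -/
def completeHomogeneous (K : Type u) [Field K] (r : ℕ) : SymFun K :=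
  ⟨fun d => if d.degree = r then 1 else 0, by
    refine ⟨rename_eq_self fun e d => ?_, r, fun d hd => if_neg hd.ne'⟩
    change (if _ then _ else _ : K) = if _ then _ else _
    rw [degree_embDomain]⟩

open Classical in
/-- The power sum symmetric function `p_n = ∑ᵢ xᵢⁿ`, for `n ≥ 1`. -/
def powerSum (K : Type u) [Field K] (n : ℕ+) : SymFun K :=
  ⟨fun d => if ∃ i, d = Finsupp.single i (n : ℕ) then 1 else 0, by
    refine ⟨rename_eq_self fun e d => ?_, n, fun d hd => if_neg ?_⟩
    · change (if _ then _ else _ : K) = if _ then _ else _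
      congr 1
      refine propext ⟨?_, ?_⟩
      · rintro ⟨i, hi⟩
        refine ⟨e.symm i, Finsupp.embDomain_injective e.toEmbedding ?_⟩
        rw [hi, Finsupp.embDomain_single]
        simp
      · rintro ⟨i, rfl⟩
        exact ⟨e i, by rw [Finsupp.embDomain_single]; rfl⟩
    · rintro ⟨i, rfl⟩
      simp at hd⟩

/-- The substitution `g ↦ g(x₀ⁿ, x₁ⁿ, …)`, that is `g ↦ p_n[g]`. -/
def powerSubst (n : ℕ+) (g : SymFun K) : SymFun K :=
  ⟨MvPowerSeries.expand n n.ne_zero (g : MvPowerSeries ℕ K), by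
    obtain ⟨g, hg, N, hN⟩ := g
    have key : ∀ d : ℕ →₀ ℕ, (∃ m : ℕ →₀ ℕ, d = (n : ℕ) • m) ∨ ∃ i, ¬ (n : ℕ) ∣ d i := by
      intro d
      by_cases h : ∃ i, ¬ (n : ℕ) ∣ d i
      · exact Or.inr h
      · push Not at h
        refine Or.inl ⟨d.mapRange (fun k => k / (n : ℕ)) (Nat.zero_div _), ?_⟩
        ext i
        simp [Nat.mul_div_cancel' (h i)]
    refine ⟨rename_eq_self fun e d => ?_, n * N, fun d hd => ?_⟩
    · rcases key d with ⟨m, rfl⟩ | ⟨i, hi⟩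
      · have h1 : ((n : ℕ) • m).embDomain e.toEmbedding =
            (n : ℕ) • m.embDomain e.toEmbedding := by
          ext i
          obtain ⟨j, rfl⟩ := e.surjective i
          have h1 := Finsupp.embDomain_apply_self e.toEmbedding ((n : ℕ) • m) j
          have h2 := Finsupp.embDomain_apply_self e.toEmbedding m j
          simp only [Equiv.coe_toEmbedding] at h1 h2
          rw [h1, Finsupp.smul_apply, Finsupp.smul_apply, h2]
        rw [h1, MvPowerSeries.coeff_expand_smul, MvPowerSeries.coeff_expand_smul]
        have h3 := MvPowerSeries.coeff_embDomain_rename e.toEmbedding g m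
        have h4 : MvPowerSeries.rename e.toEmbedding g = g := hg e
        rw [h4] at h3
        exact h3
      · rw [MvPowerSeries.coeff_expand_of_not_dvd _ _ _ hi,
          MvPowerSeries.coeff_expand_of_not_dvd _ _ _ (i := e i)]
        have h1 := Finsupp.embDomain_apply_self e.toEmbedding d i
        simp only [Equiv.coe_toEmbedding] at h1
        rwa [h1]
    · rcases key d with ⟨m, rfl⟩ | ⟨i, hi⟩
      · rw [MvPowerSeries.coeff_expand_smul]
        refine hN _ ?_
        rw [map_nsmul, smul_eq_mul] at hd
        exact lt_of_mul_lt_mul_left hd (Nat.zero_le _)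
      · exact MvPowerSeries.coeff_expand_of_not_dvd _ _ _ hi⟩

/-- The expression of a symmetric function as a polynomial in the power sums `p_1, p_2, …`; the
variable `X n` stands for `p_n`. (Over a field of characteristic zero each symmetric function has
exactly one such expression.) -/
def powerSumExpansion (f : SymFun K) : MvPolynomial ℕ+ K :=
  Function.invFun (MvPolynomial.aeval (powerSum K)) f

/-- Plethysm `f[g]`: the map `f ↦ f[g]` is the homomorphism of `K`-algebras with
`p_n[g] = g(x₀ⁿ, x₁ⁿ, …)`. -/
def plethysm (f g : SymFun K) : SymFun K :=
  MvPolynomial.aeval (fun n : ℕ+ => powerSubst n g) (powerSumExpansion f)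

/-- `z_λ = ∏ₙ n^{mₙ} mₙ!` for the partition `λ` with `mₙ` parts equal to `n`. -/
def zCoeff (m : ℕ+ →₀ ℕ) : ℕ :=
  m.prod fun n k => (n : ℕ) ^ k * k.factorial

/-- The (Hall) scalar product of symmetric functions: the bilinear form for which
`⟨p_λ, p_μ⟩ = z_λ` if `λ = μ`, and `= 0` otherwise. -/
def hallInner (f g : SymFun K) : K :=
  ∑ m ∈ (powerSumExpansion f).support,
    (zCoeff m : K) * (powerSumExpansion f).coeff m * (powerSumExpansion g).coeff m

/-- The value `f(a₁, …, aₙ, 0, 0, …)` of a symmetric function. The sum is finite, because `f` has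
bounded degree. -/
def evalFin (f : SymFun K) {n : ℕ} (a : Fin n → K) : K :=
  ∑ᶠ d : Fin n →₀ ℕ, MvPowerSeries.coeff (d.embDomain Fin.valEmbedding) (f : MvPowerSeries ℕ K) *
    ∏ i, a i ^ d i

/-- The power sum `p_{λ(π)}` of the cycle type of a permutation, fixed points being cycles of
length one. -/
def cyclePowerSum (K : Type u) [Field K] {n : ℕ} (π : Equiv.Perm (Fin n)) : SymFun K :=
  (π.partition.parts.attach.map fun i =>
    powerSum K ⟨i.1, π.partition.parts_pos i.2⟩).prod

/-- The Frobenius character `(1/n!) ∑_π Tr(τ π) p_{λ(π)}` of a representation of the symmetric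
group. -/
def frobeniusCharacter {n : ℕ} {A : Type*} [AddCommGroup A] [Module K A]
    (τ : Representation K (Equiv.Perm (Fin n)) A) : SymFun K :=
  ((n.factorial : K)⁻¹) • ∑ π : Equiv.Perm (Fin n), LinearMap.trace K A (τ π) • cyclePowerSum K π

/-! ### Affine algebraic groups and their rational representations -/

/-- The structure of an affine algebraic group over `K` on a group `G` (the group of `K`-points):
a finitely generated algebra of functions, the regular functions, such that the points of `G` are
the `K`-algebra homomorphisms from it to `K`, and such that multiplication `G × G → G` and inversion
`G → G` are morphisms, that is, pull back regular functions to regular functions. -/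
class AffineAlgebraicGroup (K : Type u) [Field K] (G : Type v) [Group G] where
  /-- The algebra of regular functions. -/
  regular : Subalgebra K (G → K)
  fg : regular.FG
  exists_unique_point : ∀ φ : regular →ₐ[K] K, ∃! g : G, ∀ f : regular, φ f = (f : G → K) g
  regular_mul : ∀ f ∈ regular, (fun x : G × G => f (x.1 * x.2)) ∈
    Submodule.span K {F : G × G → K | ∃ a ∈ regular, ∃ b ∈ regular, F = fun x => a x.1 * b x.2}
  regular_inv : ∀ f ∈ regular, (fun g => f g⁻¹) ∈ regular

/-- A representation is rational if all its matrix coefficients are regular functions. -/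
def IsRational {G : Type v} [Group G] [AffineAlgebraicGroup K G] {W : Type*} [AddCommGroup W]
    [Module K W] (ρ : Representation K G W) : Prop :=
  ∀ (w : W) (φ : Module.Dual K W),
    (fun g => φ (ρ g w)) ∈ AffineAlgebraicGroup.regular (K := K) (G := G)

/-- `G` is reductive: all its finite dimensional rational representations are completely
reducible. -/
def IsReductive (K : Type u) [Field K] (G : Type v) [Group G] [AffineAlgebraicGroup K G] : Prop :=
  ∀ (W : Type u) [AddCommGroup W] [Module K W] [FiniteDimensional K W] (ρ : Representation K G W),
    IsRational ρ → ρ.IsSemisimpleRepresentation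

/-! ### Polynomial maps and polynomial functors -/

/-- A map between vector spaces is a homogeneous polynomial map of degree `k` if it is the
restriction to the diagonal of a `k`-linear map. -/
def IsHomogeneousPolynomialMap (K : Type u) [Field K] (k : ℕ) {M N : Type*} [AddCommGroup M]
    [Module K M] [AddCommGroup N] [Module K N] (f : M → N) : Prop :=
  ∃ φ : MultilinearMap K (fun _ : Fin k => M) N, ∀ x, f x = φ fun _ => x

/-- The action of a functor `P` on linear maps. -/
def functorMap (P : FGModuleCat.{u} K ⥤ FGModuleCat.{u} K) {U W : Type u} [AddCommGroup U]
    [Module K U] [Module.Finite K U] [AddCommGroup W] [Module K W] [Module.Finite K W]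
    (f : U →ₗ[K] W) : P.obj (FGModuleCat.of K U) →ₗ[K] P.obj (FGModuleCat.of K W) :=
  (P.map (FGModuleCat.ofHom f)).hom.hom

/-- `P` is a homogeneous polynomial functor of degree `k`: for all finite dimensional `U`, `W` the
map `Hom(U, W) → Hom(P(U), P(W))` is homogeneous polynomial of degree `k`. -/
def IsHomogeneousPolynomialFunctor (k : ℕ) (P : FGModuleCat.{u} K ⥤ FGModuleCat.{u} K) : Prop :=
  ∀ (U W : Type u) [AddCommGroup U] [Module K U] [Module.Finite K U] [AddCommGroup W]
    [Module K W] [Module.Finite K W],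
    IsHomogeneousPolynomialMap K k fun f : U →ₗ[K] W => functorMap P f

/-- `F` is a character of `P`: for every invertible diagonal matrix `A` with diagonal entries
`a₁, …, aₙ` one has `F(a₁, …, aₙ, 0, 0, …) = Tr P(A)`. -/
def IsCharacter (P : FGModuleCat.{u} K ⥤ FGModuleCat.{u} K) (F : SymFun K) : Prop :=
  ∀ (n : ℕ) (a : Fin n → Kˣ), evalFin F (fun i => (a i : K)) =
    LinearMap.trace K _ (functorMap P (Matrix.toLin' (Matrix.diagonal fun i => (a i : K))))

/-- The character `ch P`, the symmetric function determined by `IsCharacter P`. -/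
def character (P : FGModuleCat.{u} K ⥤ FGModuleCat.{u} K) : SymFun K :=
  Classical.epsilon (IsCharacter P)

/-- The representation of `G` on `P(V)`, in which `g` acts as `P(ρ g)`. -/
def functorRep (P : FGModuleCat.{u} K ⥤ FGModuleCat.{u} K) {G : Type v} [Group G] {V : Type u}
    [AddCommGroup V] [Module K V] [Module.Finite K V] (ρ : Representation K G V) :
    Representation K G (P.obj (FGModuleCat.of K V)) where
  toFun g := functorMap P (ρ g)
  map_one' := by
    have h : FGModuleCat.ofHom (ρ 1) = 𝟙 (FGModuleCat.of K V) := by rw [map_one]; rfl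
    unfold functorMap
    rw [h, P.map_id]
    rfl
  map_mul' g g' := by
    have h : FGModuleCat.ofHom (ρ (g * g')) =
        FGModuleCat.ofHom (ρ g') ≫ FGModuleCat.ofHom (ρ g) := by rw [map_mul]; rfl
    unfold functorMap
    rw [h, P.map_comp]
    rfl

/-! ### Tensor invariants and invariant polynomials -/

open scoped TensorProduct

section

variable {G : Type v} [Group G] {V : Type*} [AddCommGroup V] [Module K V]

/-- The diagonal action of `G` on `V^{⊗ n}`. -/
def tensorRep (ρ : Representation K G V) (n : ℕ) : Representation K G (⨂[K] _ : Fin n, V) where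
  toFun g := PiTensorProduct.map fun _ => ρ g
  map_one' := by
    simp only [map_one]
    exact PiTensorProduct.map_one
  map_mul' g h := by
    simp only [map_mul]
    exact PiTensorProduct.map_mul _ _

/-- The action of the symmetric group on `V^{⊗ n}` by permuting the tensor factors. -/
def permRep (K : Type u) [Field K] (V : Type*) [AddCommGroup V] [Module K V] (n : ℕ) :
    Representation K (Equiv.Perm (Fin n)) (⨂[K] _ : Fin n, V) where
  toFun π := (PiTensorProduct.reindex K (fun _ : Fin n => V) π).toLinearMap
  map_one' := by
    ext x
    simp only [LinearMap.compMultilinearMap_apply, LinearEquiv.coe_coe]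
    erw [PiTensorProduct.reindex_tprod]
    rfl
  map_mul' π σ := by
    ext x
    simp only [LinearMap.compMultilinearMap_apply, LinearEquiv.coe_coe, Module.End.mul_apply]
    erw [PiTensorProduct.reindex_tprod, PiTensorProduct.reindex_tprod,
      PiTensorProduct.reindex_tprod]
    rfl

/-- The subspace `(V^{⊗ n})^G` is stable under the symmetric group. -/
def tensorInvariants (ρ : Representation K G V) (n : ℕ) : Subrepresentation (permRep K V n) where
  toSubmodule := (tensorRep ρ n).invariants
  apply_mem_toSubmodule π x hx g := by
    have h := PiTensorProduct.map_reindex (R := K) (fun _ : Fin n => ρ g) π x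
    exact h.trans (congrArg _ (hx g))

/-- `I_n(V)`: the Frobenius character of the representation of the symmetric group on
`(V^{⊗ n})^G`. -/
def tensorInvariantCharacter (ρ : Representation K G V) (n : ℕ) : SymFun K :=
  frobeniusCharacter (tensorInvariants ρ n).toRepresentation

/-- The space of `G`-invariant homogeneous polynomials (polynomial functions) of degree `r`
on `V`. -/
def invariantPolynomials (ρ : Representation K G V) (r : ℕ) : Submodule K (V → K) where
  carrier := {f | IsHomogeneousPolynomialMap K r f ∧ ∀ g v, f (ρ g v) = f v}
  zero_mem' := ⟨⟨0, fun _ => rfl⟩, fun _ _ => rfl⟩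
  add_mem' := by
    rintro f f' ⟨⟨φ, hφ⟩, hf⟩ ⟨⟨φ', hφ'⟩, hf'⟩
    exact ⟨⟨φ + φ', fun x => by simp [hφ, hφ']⟩, fun g v => by simp [hf, hf']⟩
  smul_mem' := by
    rintro c f ⟨⟨φ, hφ⟩, hf⟩
    exact ⟨⟨c • φ, fun x => by simp [hφ]⟩, fun g v => by simp [hf]⟩

/-- The Hilbert series of the graded ring of `G`-invariant polynomials on `V`. -/
def hilbertSeries (ρ : Representation K G V) : PowerSeries ℕ :=
  PowerSeries.mk fun r => Module.finrank K (invariantPolynomials ρ r)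

end

end TensorInvariants

end

/-!
The argument evaluates both sides as averages over `G`. Since `G` is reductive, some element `c` of
its group algebra acts as the projection onto the invariants both on `V^{⊗ rk}` and on
`P(V)^{⊗ r}`. In characteristic zero invariant polynomials of degree `r` on `P(V)` are invariant
symmetric forms in `r` variables, so their dimension is the trace of `c` on the symmetric power,
that is, the average with the coefficients of `c` of the values of `h_r` at the eigenvalues of
`P(ρ g)`. The trace of `π ∘ g` on `V^{⊗ n}` is the value of `p_{λ(π)}` at the eigenvalues of `ρ g`;
hence pairing `f` with `I_n(V)` gives the average of the values of `f` at these eigenvalues. It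
remains to see that `Tr P(A)` is the value of `ch P` at the eigenvalues of every endomorphism `A`.
Polarizing `A ↦ Tr P(A)` and writing `A` as a sum of operators of rank one expresses `Tr P(A)` as a
polynomial in the traces of the powers of `A` that is the same for all spaces: this is `ch P`
written in power sums.
-/

noncomputable section

namespace TensorInvariants

variable {K : Type u} [Field K]

/-! ### Symmetric functions in finitely many variables -/

theorem degree_embDomain_embedding {σ τ : Type*} (e : σ ↪ τ) (d : σ →₀ ℕ) :
    (d.embDomain e).degree = d.degree := by
  simp only [Finsupp.degree_apply, Finsupp.support_embDomain, Finset.sum_map,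
    Finsupp.embDomain_apply_self]

theorem exists_embDomain_valEmbedding_eq {n : ℕ} {d : ℕ →₀ ℕ} (hd : ∀ i ∈ d.support, i < n) :
    ∃ d' : Fin n →₀ ℕ, d'.embDomain Fin.valEmbedding = d :=
  (Finsupp.mem_range_embDomain_iff _ _).2 fun i hi => ⟨⟨i, hd i hi⟩, rfl⟩

theorem coeToMvPowerSeries_algHom_self {σ : Type*} (p : MvPolynomial σ K) :
    MvPolynomial.coeToMvPowerSeries.algHom K p = (p : MvPowerSeries σ K) := by
  rw [MvPolynomial.coeToMvPowerSeries.algHom_apply, Algebra.algebraMap_self, MvPowerSeries.map_id,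
    RingHom.id_apply]

theorem coeToMvPowerSeries_algHom_injective (σ : Type*) :
    Function.Injective (MvPolynomial.coeToMvPowerSeries.algHom (σ := σ) (R := K) K) := by
  intro p q h
  rwa [coeToMvPowerSeries_algHom_self, coeToMvPowerSeries_algHom_self,
    MvPolynomial.coe_inj] at h

theorem killCompl_mem_range_coe (n : ℕ) (f : SymFun K) :
    MvPowerSeries.killCompl Fin.valEmbedding (f : MvPowerSeries ℕ K) ∈
      (MvPolynomial.coeToMvPowerSeries.algHom (σ := Fin n) (R := K) K).range := by
  classical
  obtain ⟨f, -, N, hN⟩ := f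
  refine ⟨∑ d ∈ (Finsupp.finite_of_degree_le N).toFinset,
    MvPolynomial.monomial d (MvPowerSeries.coeff (d.embDomain Fin.valEmbedding) f), ?_⟩
  refine (coeToMvPowerSeries_algHom_self _).trans (MvPowerSeries.ext fun d => ?_)
  simp only [MvPolynomial.coeff_coe, MvPolynomial.coeff_sum, MvPolynomial.coeff_monomial,
    Finset.sum_ite_eq', MvPowerSeries.coeff_killCompl, Set.Finite.mem_toFinset, Set.mem_ofPred_eq]
  split_ifs with hd
  · rfl
  · exact (hN _ (by rwa [degree_embDomain_embedding, ← not_le])).symm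

/-- The homomorphism `f ↦ f(x₀, …, xₙ₋₁, 0, 0, …)` from symmetric functions to polynomials in `n`
variables. -/
def restrictVars (n : ℕ) : SymFun K →ₐ[K] MvPolynomial (Fin n) K :=
  (AlgEquiv.ofInjective _ (coeToMvPowerSeries_algHom_injective (Fin n))).symm.toAlgHom.comp
    (((MvPowerSeries.killCompl Fin.valEmbedding).comp (SymFun K).val).codRestrict _
      (killCompl_mem_range_coe n))

theorem coe_restrictVars (n : ℕ) (f : SymFun K) :
    (restrictVars n f : MvPowerSeries (Fin n) K) =
      MvPowerSeries.killCompl Fin.valEmbedding (f : MvPowerSeries ℕ K) := by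
  have h := congrArg Subtype.val (AlgEquiv.apply_symm_apply
    (AlgEquiv.ofInjective _ (coeToMvPowerSeries_algHom_injective (K := K) (Fin n)))
    ⟨_, killCompl_mem_range_coe n f⟩)
  rwa [AlgEquiv.ofInjective_apply, coeToMvPowerSeries_algHom_self] at h

theorem coeff_restrictVars (n : ℕ) (f : SymFun K) (d : Fin n →₀ ℕ) :
    (restrictVars n f).coeff d =
      MvPowerSeries.coeff (d.embDomain Fin.valEmbedding) (f : MvPowerSeries ℕ K) := by
  rw [← MvPolynomial.coeff_coe, coe_restrictVars, MvPowerSeries.coeff_killCompl]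

theorem evalFin_eq_eval (f : SymFun K) {n : ℕ} (a : Fin n → K) :
    evalFin f a = MvPolynomial.eval a (restrictVars n f) := by
  simp only [evalFin, MvPolynomial.eval_eq', ← coeff_restrictVars]
  exact finsum_eq_sum_of_support_subset _ fun d hd =>
    MvPolynomial.mem_support_iff.2 (left_ne_zero_of_mul hd)

theorem coeff_psum {σ R : Type*} [Fintype σ] [CommSemiring R] {m : ℕ} (hm : m ≠ 0) (d : σ →₀ ℕ)
    [Decidable (∃ i, d = Finsupp.single i m)] :
    (MvPolynomial.psum σ R m).coeff d = if ∃ i, d = Finsupp.single i m then 1 else 0 := by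
  classical
  simp only [MvPolynomial.psum, MvPolynomial.coeff_sum, MvPolynomial.coeff_X_pow]
  split_ifs with h
  · obtain ⟨i, rfl⟩ := h
    simp only [(Finsupp.single_left_injective hm).eq_iff, Finset.sum_ite_eq', Finset.mem_univ,
      if_true]
  · exact Finset.sum_eq_zero fun i _ => if_neg fun hi => h ⟨i, hi.symm⟩

theorem prod_map_X_eq_monomial {σ R : Type*} [DecidableEq σ] [CommSemiring R] (s : Multiset σ) :
    (s.map MvPolynomial.X).prod = MvPolynomial.monomial (Multiset.toFinsupp s) (1 : R) := by
  rw [MvPolynomial.monomial_eq, map_one, one_mul, Finset.prod_multiset_map_count]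
  rfl

theorem coeff_hsymm {σ R : Type*} [Fintype σ] [DecidableEq σ] [CommSemiring R] (r : ℕ)
    (d : σ →₀ ℕ) : (MvPolynomial.hsymm σ R r).coeff d = if d.degree = r then 1 else 0 := by
  have card_toMultiset : Multiset.card d.toMultiset = d.degree := Finsupp.card_toMultiset d
  have coeff_eq : (MvPolynomial.hsymm σ R r).coeff d =
      ∑ s : Sym σ r, if s.1 = d.toMultiset then 1 else 0 := by
    rw [MvPolynomial.hsymm, MvPolynomial.coeff_sum]
    refine Finset.sum_congr rfl fun s _ => ?_
    rw [prod_map_X_eq_monomial, MvPolynomial.coeff_monomial]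
    simp only [Multiset.toFinsupp_eq_iff]
  rw [coeff_eq]
  split_ifs with h
  · let s₀ : Sym σ r := ⟨d.toMultiset, card_toMultiset.trans h⟩
    rw [Fintype.sum_eq_single s₀ fun s hs => if_neg fun hs' => hs (Subtype.ext hs'), if_pos rfl]
  · exact Finset.sum_eq_zero fun s _ => if_neg fun hs =>
      h (by rw [← card_toMultiset, ← hs]; exact s.2)

theorem restrictVars_powerSum (n : ℕ) (m : ℕ+) :
    restrictVars n (powerSum K m) = MvPolynomial.psum (Fin n) K m := by
  classical
  ext d
  rw [coeff_restrictVars, coeff_psum m.ne_zero]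
  change (if _ then _ else _ : K) = _
  refine if_congr ⟨fun ⟨i, hi⟩ => ?_, fun ⟨i, hi⟩ => ⟨i, ?_⟩⟩ rfl rfl
  · have hmem : i ∈ (d.embDomain Fin.valEmbedding).support := by
      simp [hi]
    obtain ⟨j, -, rfl⟩ := Finset.mem_map.1 (Finsupp.support_embDomain Fin.valEmbedding d ▸ hmem)
    exact ⟨j, Finsupp.embDomain_injective Fin.valEmbedding
      (hi.trans (Finsupp.embDomain_single _ _ _).symm)⟩
  · rw [hi, Finsupp.embDomain_single, Fin.valEmbedding_apply]

theorem restrictVars_completeHomogeneous (n r : ℕ) :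
    restrictVars n (completeHomogeneous K r) = MvPolynomial.hsymm (Fin n) K r := by
  ext d
  rw [coeff_restrictVars, coeff_hsymm, ← degree_embDomain_embedding Fin.valEmbedding]
  change (if _ then _ else _ : K) = _
  congr

theorem symFun_ext_restrictVars {f g : SymFun K} (h : ∀ n, restrictVars n f = restrictVars n g) :
    f = g := by
  refine Subtype.ext (MvPowerSeries.ext fun d => ?_)
  obtain ⟨d', hd'⟩ := exists_embDomain_valEmbedding_eq
    fun i hi => Nat.lt_succ_of_le (Finset.le_sup (s := d.support) (f := id) hi)
  rw [← hd', ← coeff_restrictVars, ← coeff_restrictVars, h]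

theorem symFun_ext_evalFin [CharZero K] {f g : SymFun K}
    (h : ∀ (n : ℕ) (a : Fin n → Kˣ),
      evalFin f (fun i => (a i : K)) = evalFin g fun i => (a i : K)) :
    f = g := by
  refine symFun_ext_restrictVars fun n => MvPolynomial.funext_set (fun _ => {0}ᶜ)
    (fun _ => (Set.finite_singleton 0).infinite_compl) fun x hx => ?_
  have hx : ∀ i, x i ≠ 0 := fun i => hx i (Set.mem_univ i)
  simpa only [evalFin_eq_eval, Units.val_mk0] using h n fun i => Units.mk0 (x i) (hx i)

/-! ### Expansions in power sums -/

theorem restrictVars_aeval_powerSum (n : ℕ) (q : MvPolynomial ℕ+ K) :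
    restrictVars n (MvPolynomial.aeval (powerSum K) q) =
      MvPolynomial.aeval (fun m : ℕ+ => MvPolynomial.psum (Fin n) K m) q := by
  rw [← AlgHom.comp_apply, MvPolynomial.comp_aeval]
  simp only [restrictVars_powerSum]

theorem evalFin_aeval_powerSum (q : MvPolynomial ℕ+ K) {n : ℕ} (a : Fin n → K) :
    evalFin (MvPolynomial.aeval (powerSum K) q) a =
      MvPolynomial.eval (fun m : ℕ+ => ∑ i, a i ^ (m : ℕ)) q := by
  rw [evalFin_eq_eval, restrictVars_aeval_powerSum, ← MvPolynomial.coe_aeval_eq_eval,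
    RingHom.coe_coe, ← AlgHom.comp_apply, MvPolynomial.comp_aeval]
  simp only [MvPolynomial.psum, map_sum, map_pow, MvPolynomial.aeval_X,
    MvPolynomial.aeval_eq_eval]

theorem exists_forall_sum_pow_mul_eq [CharZero K] (N : ℕ) (t : Fin N → K) :
    ∃ c : Fin N → K, ∀ j : Fin N, ∑ i : Fin N, ((i : ℕ) + 1 : K) ^ ((j : ℕ) + 1) * c i = t j := by
  set x : Fin N → K := fun i => (i : ℕ) + 1
  have hx : Function.Injective x := fun i j hij => Fin.ext (by simpa [x] using hij)
  have hunit : IsUnit ((Matrix.vandermonde x).transpose * Matrix.diagonal x) := by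
    rw [Matrix.isUnit_iff_isUnit_det, Matrix.det_mul, Matrix.det_transpose, Matrix.det_diagonal,
      isUnit_iff_ne_zero]
    exact mul_ne_zero (Matrix.det_vandermonde_ne_zero_iff.2 hx)
      (Finset.prod_ne_zero_iff.2 fun i _ => Nat.cast_add_one_ne_zero _)
  obtain ⟨c, hc⟩ := Matrix.mulVec_surjective_iff_isUnit.2 hunit t
  refine ⟨c, fun j => ?_⟩
  rw [← hc]
  simp only [Matrix.mulVec, dotProduct, Matrix.mul_diagonal, Matrix.transpose_apply,
    Matrix.vandermonde_apply, pow_succ, x]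

theorem exists_sum_pow_eq_sum_mul_pow {R : Type*} [CommSemiring R] {N : ℕ} (c : Fin N → ℕ)
    (x : Fin N → R) : ∃ a : Fin (∑ i, c i) → R,
      ∀ m : ℕ, ∑ j, a j ^ m = ∑ i, x i ^ m * c i := by
  refine ⟨fun j => x (finSigmaFinEquiv.symm j).1, fun m => ?_⟩
  rw [← finSigmaFinEquiv.sum_comp]
  simp only [Equiv.symm_apply_apply, Fintype.sum_sigma, Finset.sum_const, Finset.card_univ,
    Fintype.card_fin, nsmul_eq_mul, mul_comm]

/-- By density of the natural numbers in `K`, a polynomial relation between the power sums also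
holds for tuples with multiplicities in `K`, and those attain all values of finitely many power
sums. -/
theorem algebraicIndependent_powerSum [CharZero K] : AlgebraicIndependent K (powerSum K) := by
  refine (injective_iff_map_eq_zero _).2 fun f hf => MvPolynomial.funext fun t => ?_
  obtain ⟨N, hN⟩ : ∃ N : ℕ, ∀ m ∈ f.vars, (m : ℕ) ≤ N :=
    ⟨f.vars.sup PNat.val, fun m hm => Finset.le_sup (f := PNat.val) hm⟩
  let x : Fin N → K := fun i => (i : ℕ) + 1
  let g : MvPolynomial (Fin N) K := MvPolynomial.aeval (fun m : ℕ+ =>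
    ∑ i, MvPolynomial.C (x i ^ (m : ℕ)) * MvPolynomial.X i) f
  have eval_g (c : Fin N → K) : MvPolynomial.eval c g =
      MvPolynomial.eval (fun m : ℕ+ => ∑ i, x i ^ (m : ℕ) * c i) f := by
    simp only [g, ← MvPolynomial.coe_aeval_eq_eval, RingHom.coe_coe]
    rw [← AlgHom.comp_apply, MvPolynomial.comp_aeval]
    simp
  have g_eq_zero : g = 0 := by
    refine MvPolynomial.funext_set (fun _ => Set.range (Nat.cast : ℕ → K))
      (fun _ => Set.infinite_range_of_injective Nat.cast_injective) fun y hy => ?_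
    choose c hc using fun i => hy i (Set.mem_univ i)
    obtain ⟨a, ha⟩ := exists_sum_pow_eq_sum_mul_pow c x
    have h := evalFin_aeval_powerSum f a
    rw [hf, evalFin_eq_eval, map_zero, map_zero] at h
    simp only [map_zero, eval_g, ← hc, ← ha, ← h]
  obtain ⟨c, hc⟩ := exists_forall_sum_pow_mul_eq N fun j : Fin N => t ⟨j + 1, j.1.succ_pos⟩
  have h := eval_g c
  rw [g_eq_zero, map_zero] at h
  rw [map_zero, h]
  refine MvPolynomial.eval₂Hom_congr' rfl (fun m hm _ => ?_) rfl
  have hm' : (m : ℕ) - 1 + 1 = m := Nat.sub_add_cancel m.pos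
  have hcm := hc ⟨m - 1, (Nat.sub_lt m.pos one_pos).trans_le (hN m hm)⟩
  simp only [hm'] at hcm
  exact hcm.symm

theorem powerSumExpansion_aeval [CharZero K] (q : MvPolynomial ℕ+ K) :
    powerSumExpansion (MvPolynomial.aeval (powerSum K) q) = q :=
  Function.leftInverse_invFun algebraicIndependent_powerSum q

/-! ### Plethysm in terms of power sums -/

theorem killCompl_expand {σ τ R : Type*} [CommRing R] (e : σ ↪ τ) {n : ℕ} (hn : n ≠ 0)
    (f : MvPowerSeries τ R) : MvPowerSeries.killCompl e (MvPowerSeries.expand n hn f) =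
      MvPowerSeries.expand n hn (MvPowerSeries.killCompl e f) := by
  ext d
  rw [MvPowerSeries.coeff_killCompl]
  by_cases h : ∀ i, n ∣ d i
  · obtain ⟨d, rfl⟩ : ∃ d' : σ →₀ ℕ, d = n • d' :=
      ⟨d.mapRange (· / n) (Nat.zero_div n), Finsupp.ext fun i => (Nat.mul_div_cancel' (h i)).symm⟩
    rw [Finsupp.embDomain_eq_mapDomain, Finsupp.mapDomain_smul, MvPowerSeries.coeff_expand_smul,
      MvPowerSeries.coeff_expand_smul, MvPowerSeries.coeff_killCompl,
      Finsupp.embDomain_eq_mapDomain]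
  · obtain ⟨i, hi⟩ := not_forall.1 h
    rw [MvPowerSeries.coeff_expand_of_not_dvd _ _ _ hi,
      MvPowerSeries.coeff_expand_of_not_dvd _ _ _ (i := e i)]
    rwa [Finsupp.embDomain_apply_self]

theorem restrictVars_powerSubst (N : ℕ) (n : ℕ+) (g : SymFun K) :
    restrictVars N (powerSubst n g) = MvPolynomial.expand n (restrictVars N g) := by
  refine MvPolynomial.coe_injective _ _ ?_
  rw [coe_restrictVars, ← MvPowerSeries.expand_eq_expand _ n.ne_zero, coe_restrictVars]
  exact killCompl_expand _ n.ne_zero _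

theorem powerSubst_powerSum (n m : ℕ+) : powerSubst n (powerSum K m) = powerSum K (n * m) := by
  refine symFun_ext_restrictVars fun N => ?_
  simp only [restrictVars_powerSubst, restrictVars_powerSum, MvPolynomial.psum, map_sum, map_pow,
    MvPolynomial.expand_X, PNat.mul_coe, pow_mul]

/-- The substitution `g ↦ p_n[g]` as a homomorphism of algebras. -/
def powerSubstHom (n : ℕ+) : SymFun K →ₐ[K] SymFun K :=
  ((MvPowerSeries.expand n n.ne_zero).comp (SymFun K).val).codRestrict (SymFun K)
    fun g => (powerSubst n g).2

theorem powerSubstHom_apply (n : ℕ+) (g : SymFun K) : powerSubstHom n g = powerSubst n g := rfl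

theorem powerSubst_aeval (n : ℕ+) (q : MvPolynomial ℕ+ K) :
    powerSubst n (MvPolynomial.aeval (powerSum K) q) =
      MvPolynomial.aeval (powerSum K) (MvPolynomial.rename (n * ·) q) := by
  rw [← powerSubstHom_apply, ← AlgHom.comp_apply, MvPolynomial.comp_aeval,
    MvPolynomial.aeval_rename]
  simp only [powerSubstHom_apply, powerSubst_powerSum]
  rfl

/-- Plethysm on the polynomial ring in the variables `X n`, where `X n` stands for `p_n`. -/
def plethysmPoly (p q : MvPolynomial ℕ+ K) : MvPolynomial ℕ+ K :=
  MvPolynomial.aeval (fun n => MvPolynomial.rename (n * ·) q) p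

theorem plethysm_aeval [CharZero K] (p q : MvPolynomial ℕ+ K) :
    plethysm (MvPolynomial.aeval (powerSum K) p) (MvPolynomial.aeval (powerSum K) q) =
      MvPolynomial.aeval (powerSum K) (plethysmPoly p q) := by
  rw [plethysm, powerSumExpansion_aeval, plethysmPoly, ← AlgHom.comp_apply,
    MvPolynomial.comp_aeval]
  simp only [powerSubst_aeval]

theorem isWeightedHomogeneous_aeval {R σ τ M N : Type*} [CommSemiring R] [AddCommMonoid M]
    [AddCommMonoid N] {w : σ → M} {w' : τ → N} (φ : M →+ N) {f : σ → MvPolynomial τ R}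
    (hf : ∀ i, MvPolynomial.IsWeightedHomogeneous w' (f i) (φ (w i))) {p : MvPolynomial σ R}
    {m : M} (hp : MvPolynomial.IsWeightedHomogeneous w p m) :
    MvPolynomial.IsWeightedHomogeneous w' (MvPolynomial.aeval f p) (φ m) := by
  rw [MvPolynomial.aeval_def, MvPolynomial.eval₂_eq]
  refine MvPolynomial.IsWeightedHomogeneous.sum _ _ _ fun d hd => ?_
  rw [← hp (MvPolynomial.mem_support_iff.1 hd), Finsupp.weight_apply, map_finsuppSum,
    MvPolynomial.algebraMap_eq]
  refine MvPolynomial.IsWeightedHomogeneous.C_mul ?_ _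
  refine MvPolynomial.IsWeightedHomogeneous.prod _ _ _ fun i _ => ?_
  simpa only [map_nsmul] using (hf i).pow (d i)

theorem isWeightedHomogeneous_rename_mul (n : ℕ+) {q : MvPolynomial ℕ+ K} {k : ℕ}
    (hq : MvPolynomial.IsWeightedHomogeneous PNat.val q k) :
    MvPolynomial.IsWeightedHomogeneous PNat.val (MvPolynomial.rename (n * ·) q) (n * k) := by
  have isWeightedHomogeneous_X_mul (m : ℕ+) : MvPolynomial.IsWeightedHomogeneous PNat.val
      (MvPolynomial.X (n * m) : MvPolynomial ℕ+ K) (AddMonoidHom.mulLeft (n : ℕ) m) :=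
    MvPolynomial.isWeightedHomogeneous_X K PNat.val (n * m)
  rw [MvPolynomial.aeval_unique (MvPolynomial.rename _), Function.comp_def]
  simp only [MvPolynomial.rename_X]
  exact isWeightedHomogeneous_aeval (AddMonoidHom.mulLeft (n : ℕ)) isWeightedHomogeneous_X_mul hq

theorem isWeightedHomogeneous_plethysmPoly {p q : MvPolynomial ℕ+ K} {r k : ℕ}
    (hp : MvPolynomial.IsWeightedHomogeneous PNat.val p r)
    (hq : MvPolynomial.IsWeightedHomogeneous PNat.val q k) :
    MvPolynomial.IsWeightedHomogeneous PNat.val (plethysmPoly p q) (r * k) :=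
  isWeightedHomogeneous_aeval (AddMonoidHom.mulRight k)
    (fun n => isWeightedHomogeneous_rename_mul n hq) hp

/-! ### Traces over the cycles of a permutation -/

section cycleSum

variable {ι α R : Type*} [Fintype ι] [CommSemiring R]

/-- The sum `∑_i ∏_j A (i (σ j)) (i j)` over all families `i : α → ι`: the trace of the composition
of the tensor power of the matrix `A` with the permutation of the tensor factors by `σ`. -/
def cycleSum [Fintype α] [DecidableEq α] (A : Matrix ι ι R) (σ : Equiv.Perm α) : R :=
  ∑ i : α → ι, ∏ j, A (i (σ j)) (i j)

theorem cycleSum_inv [Fintype α] [DecidableEq α] (A : Matrix ι ι R) (σ : Equiv.Perm α) :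
    cycleSum A σ⁻¹ = ∑ i : α → ι, ∏ j, A (i j) (i (σ j)) :=
  Finset.sum_congr rfl fun i _ => by
    rw [← Equiv.prod_comp σ]
    simp

theorem sum_prod_path_eq [DecidableEq ι] (A : Matrix ι ι R) (m : ℕ) (F : ι → ι → R) :
    ∑ i : Fin (m + 1) → ι, F (i 0) (i (Fin.last m)) * ∏ k : Fin m, A (i k.succ) (i k.castSucc) =
      ∑ x, ∑ y, F x y * (A ^ m) y x := by
  induction m generalizing F with
  | zero =>
    rw [← (Equiv.funUnique (Fin 1) ι).symm.sum_comp]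
    simp [Matrix.one_apply]
  | succ m ih =>
    have sum_cons (i : Fin (m + 1) → ι) :
        ∑ x, F x (i (Fin.last m)) * ∏ k : Fin (m + 1),
            A (i k) (Fin.cons (α := fun _ => ι) x i k.castSucc) =
          (∑ x, F x (i (Fin.last m)) * A (i 0) x) *
            ∏ k : Fin m, A (i k.succ) (i k.castSucc) := by
      simp only [Fin.prod_univ_succ, Fin.castSucc_zero, Fin.cons_zero, Fin.castSucc_succ,
        Fin.cons_succ, Finset.sum_mul, mul_assoc]
    rw [← (Fin.consEquiv fun _ => ι).sum_comp, Fintype.sum_prod_type, Finset.sum_comm]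
    simp only [Fin.consEquiv_apply, Fin.cons_zero, Fin.cons_succ, ← Fin.succ_last, sum_cons]
    rw [ih fun y z => ∑ x, F x z * A y x, Finset.sum_comm]
    simp only [pow_succ, Matrix.mul_apply, Finset.sum_mul, Finset.mul_sum]
    conv_rhs => rw [Finset.sum_comm]
    refine Finset.sum_congr rfl fun z _ => ?_
    rw [Finset.sum_comm]
    exact Finset.sum_congr rfl fun x _ => Finset.sum_congr rfl fun y _ => by ring

theorem exists_equiv_fin_of_sameCycle [Finite α] [Nonempty α] {σ : Equiv.Perm α}
    (h : ∀ x y, σ.SameCycle x y) : ∃ (m : ℕ) (e : Fin (m + 1) ≃ α),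
      (∀ k : Fin m, e k.succ = σ (e k.castSucc)) ∧ e 0 = σ (e (Fin.last m)) := by
  cases nonempty_fintype α
  obtain ⟨x⟩ := ‹Nonempty α›
  have isCycleOn : σ.IsCycleOn (Finset.univ : Finset α) := by
    simpa using ⟨σ.bijective.bijOn_univ, fun y _ z _ => h y z⟩
  obtain ⟨m, hm⟩ := Nat.exists_eq_succ_of_ne_zero (Fintype.card_ne_zero (α := α))
  have bijective_pow : Function.Bijective fun k : Fin (m + 1) => (σ ^ (k : ℕ)) x := by
    rw [Fintype.bijective_iff_surjective_and_card, Fintype.card_fin, hm]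
    refine ⟨fun y => ?_, rfl⟩
    obtain ⟨k, hk, rfl⟩ := isCycleOn.exists_pow_eq (Finset.mem_univ x) (Finset.mem_univ y)
    exact ⟨⟨k, by rwa [Finset.card_univ, hm] at hk⟩, rfl⟩
  refine ⟨m, Equiv.ofBijective _ bijective_pow, fun k => ?_, ?_⟩
  · simp only [Equiv.ofBijective_apply, Fin.val_succ, Fin.val_castSucc, pow_succ',
      Equiv.Perm.mul_apply]
  · have pow_card := isCycleOn.pow_card_apply (Finset.mem_univ x)
    rw [Finset.card_univ, hm, Nat.succ_eq_add_one, pow_succ', Equiv.Perm.mul_apply] at pow_card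
    exact pow_card.symm

variable [Fintype α] [DecidableEq α]

theorem cycleSum_one (A : Matrix ι ι R) :
    cycleSum A (1 : Equiv.Perm α) = Matrix.trace A ^ Fintype.card α := by
  simp only [cycleSum, Equiv.Perm.one_apply, Matrix.trace, Matrix.diag_apply]
  rw [← Finset.card_univ, ← Finset.prod_const, Finset.prod_univ_sum, Fintype.piFinset_univ]

theorem cycleSum_of_sameCycle [DecidableEq ι] [Nonempty α] (A : Matrix ι ι R) {σ : Equiv.Perm α}
    (h : ∀ x y, σ.SameCycle x y) : cycleSum A σ = Matrix.trace (A ^ Fintype.card α) := by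
  obtain ⟨m, e, he, he0⟩ := exists_equiv_fin_of_sameCycle h
  have prod_eq (i : α → ι) : ∏ j, A (i (σ j)) (i j) =
      A (i (e 0)) (i (e (Fin.last m))) *
        ∏ k : Fin m, A (i (e k.succ)) (i (e k.castSucc)) := by
    rw [← e.prod_comp, Fin.prod_univ_castSucc, mul_comm]
    simp only [he, he0]
  have sum_eq := sum_prod_path_eq A m fun x y => A x y
  rw [← (e.symm.arrowCongr (Equiv.refl ι)).sum_comp] at sum_eq
  rw [Fintype.card_congr e.symm, Fintype.card_fin, cycleSum]
  simp only [prod_eq]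
  refine sum_eq.trans ?_
  simp only [Matrix.trace, Matrix.diag_apply, pow_succ', Matrix.mul_apply]

theorem cycleSum_eq_prod_fiber {Q : Type*} [Fintype Q] [DecidableEq Q] (A : Matrix ι ι R)
    (σ : Equiv.Perm α) (f : α → Q) (hf : ∀ j, f (σ j) = f j) :
    cycleSum A σ =
      ∏ q, cycleSum A (σ.subtypePerm (p := fun j => f j = q) fun j => by rw [hf]) := by
  let glue : (∀ q, {j // f j = q} → ι) ≃ (α → ι) :=
    (Equiv.piCurry fun _ _ => ι).symm.trans
      ((Equiv.sigmaFiberEquiv f).arrowCongr (Equiv.refl ι))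
  have glue_apply (i : ∀ q, {j // f j = q} → ι) (q : Q) (j : {j // f j = q}) :
      glue i j = i q j := by
    obtain ⟨j, rfl⟩ := j
    rfl
  simp only [cycleSum]
  rw [Finset.prod_univ_sum, Fintype.piFinset_univ, ← glue.sum_comp]
  refine Finset.sum_congr rfl fun i _ => ?_
  rw [← (Equiv.sigmaFiberEquiv f).prod_comp, Fintype.prod_sigma]
  refine Finset.prod_congr rfl fun q _ => Finset.prod_congr rfl fun j _ => ?_
  rw [← glue_apply i q j, ← glue_apply i q (σ.subtypePerm _ j)]
  rfl

theorem cycleOf_eq_iff_mem_support {σ c : Equiv.Perm α} (hc : c ∈ σ.cycleFactorsFinset) (x : α) :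
    σ.cycleOf x = c ↔ x ∈ c.support := by
  refine ⟨?_, fun hx => (Equiv.Perm.cycle_is_cycleOf hx hc).symm⟩
  rintro rfl
  exact Equiv.Perm.mem_support_cycleOf_iff.2
    ⟨Equiv.Perm.SameCycle.refl _ _, Equiv.Perm.cycleOf_mem_cycleFactorsFinset_iff.1 hc⟩

theorem cycleSum_cycleOf_fiber [DecidableEq ι] (A : Matrix ι ι R) {σ c : Equiv.Perm α}
    (hc : c ∈ σ.cycleFactorsFinset) :
    cycleSum A (σ.subtypePerm (p := fun x => σ.cycleOf x = c) fun x => by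
      rw [Equiv.Perm.cycleOf_self_apply]) = Matrix.trace (A ^ c.support.card) := by
  obtain ⟨x, hx⟩ := (Equiv.Perm.mem_cycleFactorsFinset_iff.1 hc).1.nonempty_support
  have : Nonempty {x // σ.cycleOf x = c} := ⟨x, (cycleOf_eq_iff_mem_support hc x).2 hx⟩
  rw [cycleSum_of_sameCycle, Fintype.card_of_subtype _ fun y =>
    (cycleOf_eq_iff_mem_support hc y).symm]
  rintro ⟨y, hy⟩ ⟨z, hz⟩
  rw [Equiv.Perm.sameCycle_subtypePerm]
  exact (Equiv.Perm.mem_support_cycleOf_iff.1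
    (hy ▸ (cycleOf_eq_iff_mem_support hc z).1 hz)).1

theorem cycleSum_cycleOf_fiber_one (A : Matrix ι ι R) (σ : Equiv.Perm α) :
    cycleSum A (σ.subtypePerm (p := fun x => σ.cycleOf x = 1) fun x => by
      rw [Equiv.Perm.cycleOf_self_apply]) =
        Matrix.trace A ^ (Fintype.card α - σ.support.card) := by
  have subtypePerm_eq_one : σ.subtypePerm (p := fun x => σ.cycleOf x = 1) (fun x => by
      rw [Equiv.Perm.cycleOf_self_apply]) = 1 :=
    Equiv.ext fun x => Subtype.ext ((Equiv.Perm.cycleOf_eq_one_iff σ).1 x.2)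
  rw [subtypePerm_eq_one, cycleSum_one, ← Finset.card_compl, Fintype.card_of_subtype σ.supportᶜ]
  simp

theorem cycleSum_eq_prod_parts [DecidableEq ι] (A : Matrix ι ι R) (σ : Equiv.Perm α) :
    cycleSum A σ = (σ.partition.parts.map fun m => Matrix.trace (A ^ m)).prod := by
  have one_notMem : (1 : Equiv.Perm α) ∉ σ.cycleFactorsFinset := fun h =>
    Equiv.Perm.not_isCycle_one (Equiv.Perm.mem_cycleFactorsFinset_iff.1 h).1
  rw [cycleSum_eq_prod_fiber A σ σ.cycleOf fun x => Equiv.Perm.cycleOf_self_apply σ x,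
    ← Finset.prod_subset (Finset.subset_univ (insert 1 σ.cycleFactorsFinset)),
    Finset.prod_insert one_notMem, cycleSum_cycleOf_fiber_one,
    Finset.prod_congr rfl fun c hc => cycleSum_cycleOf_fiber A hc, Equiv.Perm.parts_partition,
    Multiset.map_add, Multiset.prod_add, Equiv.Perm.cycleType_def, Multiset.map_map,
    Multiset.map_replicate, Multiset.prod_replicate, pow_one, mul_comm]
  · rfl
  · intro c _ hc
    have : IsEmpty {x // σ.cycleOf x = c} := by
      refine ⟨?_⟩
      rintro ⟨x, rfl⟩
      rw [Finset.mem_insert, not_or, Equiv.Perm.cycleOf_eq_one_iff,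
        Equiv.Perm.cycleOf_mem_cycleFactorsFinset_iff, Equiv.Perm.notMem_support] at hc
      exact hc.1 hc.2
    simp only [cycleSum, Finset.univ_eq_empty, Finset.prod_empty, Finset.sum_const,
      Finset.card_univ, Fintype.card_unique, one_smul]

end cycleSum

/-! ### Cycle monomials -/

section cycleMonomial

variable {α : Type*} [Fintype α] [DecidableEq α]

/-- The lengths of the cycles of a permutation, fixed points being cycles of length one. -/
def cycleLengths (π : Equiv.Perm α) : Multiset ℕ+ :=
  π.partition.parts.attach.map fun i => ⟨i.1, π.partition.parts_pos i.2⟩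

theorem map_val_cycleLengths (π : Equiv.Perm α) :
    (cycleLengths π).map PNat.val = π.partition.parts :=
  (Multiset.map_map _ _ _).trans (Multiset.attach_map_val _)

/-- The monomial `∏ X m` over the cycle lengths `m` of a permutation, which becomes the power sum of
its cycle type when `p_m` is substituted for `X m`. -/
def cycleMonomial (R : Type*) [CommSemiring R] (π : Equiv.Perm α) : MvPolynomial ℕ+ R :=
  ((cycleLengths π).map MvPolynomial.X).prod

theorem cycleMonomial_eq_monomial (R : Type*) [CommSemiring R] (π : Equiv.Perm α) :
    cycleMonomial R π = MvPolynomial.monomial (Multiset.toFinsupp (cycleLengths π)) 1 :=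
  prod_map_X_eq_monomial _

theorem aeval_cycleMonomial {R S : Type*} [CommSemiring R] [CommSemiring S] [Algebra R S]
    (t : ℕ+ → S) (π : Equiv.Perm α) :
    MvPolynomial.aeval t (cycleMonomial R π) = ((cycleLengths π).map t).prod := by
  simp only [cycleMonomial, map_multiset_prod, Multiset.map_map, Function.comp_def,
    MvPolynomial.aeval_X]

theorem aeval_powerSum_cycleMonomial {n : ℕ} (π : Equiv.Perm (Fin n)) :
    MvPolynomial.aeval (powerSum K) (cycleMonomial K π) = cyclePowerSum K π := by
  rw [aeval_cycleMonomial]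
  exact congrArg Multiset.prod (Multiset.map_map _ _ _)

theorem aeval_trace_pow_cycleMonomial {R S ι : Type*} [CommSemiring R] [CommSemiring S]
    [Algebra R S] [Fintype ι] [DecidableEq ι] (A : Matrix ι ι S) (π : Equiv.Perm α) :
    MvPolynomial.aeval (fun m : ℕ+ => Matrix.trace (A ^ (m : ℕ))) (cycleMonomial R π) =
      cycleSum A π := by
  rw [aeval_cycleMonomial, cycleSum_eq_prod_parts, ← map_val_cycleLengths, Multiset.map_map]
  rfl

theorem weight_val_toFinsupp (s : Multiset ℕ+) :
    Finsupp.weight PNat.val (Multiset.toFinsupp s) = (s.map PNat.val).sum := by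
  rw [Finsupp.weight_apply, Finset.sum_multiset_map_count]
  rfl

theorem isWeightedHomogeneous_cycleMonomial (R : Type*) [CommSemiring R] (π : Equiv.Perm α) :
    MvPolynomial.IsWeightedHomogeneous PNat.val (cycleMonomial R π) (Fintype.card α) := by
  rw [cycleMonomial_eq_monomial]
  refine MvPolynomial.isWeightedHomogeneous_monomial _ _ _ ?_
  rw [weight_val_toFinsupp, map_val_cycleLengths, π.partition.parts_sum]

end cycleMonomial

/-! ### The scalar product with a Frobenius character -/

theorem filter_two_le_add_replicate_count_one {M : Multiset ℕ} (hM : ∀ k ∈ M, 0 < k) :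
    M.filter (2 ≤ ·) + Multiset.replicate (M.count 1) 1 = M := by
  have filter_not : M.filter (¬ 2 ≤ ·) = Multiset.replicate (M.count 1) 1 := by
    rw [← Multiset.filter_eq']
    refine Multiset.filter_congr fun k hk => ?_
    have := hM k hk
    omega
  rw [← filter_not, Multiset.filter_add_not]

theorem pos_of_mem_map_val {s : Multiset ℕ+} {k : ℕ} (hk : k ∈ s.map PNat.val) : 0 < k := by
  obtain ⟨m, -, rfl⟩ := Multiset.mem_map.1 hk
  exact m.pos

theorem sum_filter_two_le_add_count_one (s : Multiset ℕ+) :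
    ((s.map PNat.val).filter (2 ≤ ·)).sum + (s.map PNat.val).count 1 = (s.map PNat.val).sum := by
  have h := congrArg Multiset.sum
    (filter_two_le_add_replicate_count_one fun k => pos_of_mem_map_val (s := s) (k := k))
  rwa [Multiset.sum_add, Multiset.sum_replicate, smul_eq_mul, mul_one] at h

theorem cycleLengths_eq_iff {α : Type*} [Fintype α] [DecidableEq α] {s : Multiset ℕ+}
    (hs : (s.map PNat.val).sum = Fintype.card α) (π : Equiv.Perm α) :
    cycleLengths π = s ↔ π.cycleType = (s.map PNat.val).filter (2 ≤ ·) := by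
  rw [← (Multiset.map_injective PNat.coe_injective).eq_iff]
  rw [map_val_cycleLengths]
  refine ⟨fun h => by rw [← h, Equiv.Perm.filter_parts_partition_eq_cycleType], fun h => ?_⟩
  rw [Equiv.Perm.parts_partition, ← Equiv.Perm.sum_cycleType, h, ← hs,
    ← sum_filter_two_le_add_count_one, Nat.add_sub_cancel_left]
  exact filter_two_le_add_replicate_count_one fun k => pos_of_mem_map_val

theorem prod_factorial_count_eq (s : Multiset ℕ+) :
    ∏ m ∈ s.toFinset, (s.count m).factorial = ((s.map PNat.val).count 1).factorial *
      ∏ k ∈ ((s.map PNat.val).filter (2 ≤ ·)).toFinset,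
        (((s.map PNat.val).filter (2 ≤ ·)).count k).factorial := by
  have one_notMem : 1 ∉ ((s.map PNat.val).filter (2 ≤ ·)).toFinset := by simp
  have toFinset_subset : (s.map PNat.val).toFinset ⊆
      insert 1 ((s.map PNat.val).filter (2 ≤ ·)).toFinset := fun k hk => by
    rw [Multiset.mem_toFinset] at hk
    rw [Finset.mem_insert, Multiset.mem_toFinset, Multiset.mem_filter, or_iff_not_imp_left]
    exact fun hk1 => ⟨hk, (Nat.succ_le_of_lt (pos_of_mem_map_val hk)).lt_of_ne' hk1⟩
  calc ∏ m ∈ s.toFinset, (s.count m).factorial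
      = ∏ k ∈ (s.map PNat.val).toFinset, ((s.map PNat.val).count k).factorial := by
        rw [Multiset.toFinset_map, Finset.prod_image PNat.coe_injective.injOn]
        exact Finset.prod_congr rfl fun m _ => congrArg Nat.factorial
          (Multiset.count_map_eq_count' _ s PNat.coe_injective m).symm
    _ = ∏ k ∈ insert 1 ((s.map PNat.val).filter (2 ≤ ·)).toFinset,
          ((s.map PNat.val).count k).factorial :=
        Finset.prod_subset toFinset_subset fun k _ hk => by
          rw [Multiset.count_eq_zero_of_notMem fun h => hk (Multiset.mem_toFinset.2 h),
            Nat.factorial_zero]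
    _ = _ := by
        rw [Finset.prod_insert one_notMem]
        congr 1
        refine Finset.prod_congr rfl fun k hk => ?_
        rw [Multiset.count_filter_of_pos
          (Multiset.mem_filter.1 (Multiset.mem_toFinset.1 hk)).2]

theorem zCoeff_toFinsupp (s : Multiset ℕ+) : zCoeff (Multiset.toFinsupp s) =
    ((s.map PNat.val).count 1).factorial * ((s.map PNat.val).filter (2 ≤ ·)).prod *
      ∏ k ∈ ((s.map PNat.val).filter (2 ≤ ·)).toFinset,
        (((s.map PNat.val).filter (2 ≤ ·)).count k).factorial := by
  have prod_filter : ((s.map PNat.val).filter (2 ≤ ·)).prod = (s.map PNat.val).prod := by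
    have h := congrArg Multiset.prod
      (filter_two_le_add_replicate_count_one fun k => pos_of_mem_map_val (s := s) (k := k))
    rwa [Multiset.prod_add, Multiset.prod_replicate, one_pow, mul_one] at h
  rw [prod_filter, mul_comm (Nat.factorial _), mul_assoc, ← prod_factorial_count_eq,
    Finset.prod_multiset_map_count, ← Finset.prod_mul_distrib]
  rfl

theorem card_cycleLengths_mul_zCoeff {α : Type*} [Fintype α] [DecidableEq α] {s : Multiset ℕ+}
    (hs : (s.map PNat.val).sum = Fintype.card α) :
    (Finset.univ.filter fun π : Equiv.Perm α => cycleLengths π = s).card *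
      zCoeff (Multiset.toFinsupp s) = (Fintype.card α).factorial := by
  have h := Equiv.Perm.card_of_cycleType_mul_eq α ((s.map PNat.val).filter (2 ≤ ·))
  rw [← hs, ← sum_filter_two_le_add_count_one, Nat.add_sub_cancel_left,
    if_pos ⟨Nat.le_add_right _ _, fun k hk => (Multiset.mem_filter.1 hk).2⟩,
    sum_filter_two_le_add_count_one, hs] at h
  simpa only [cycleLengths_eq_iff hs, zCoeff_toFinsupp] using h

theorem hallInner_aeval_powerSum [CharZero K] (p q : MvPolynomial ℕ+ K) :
    hallInner (MvPolynomial.aeval (powerSum K) p) (MvPolynomial.aeval (powerSum K) q) =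
      ∑ m ∈ p.support, zCoeff m * p.coeff m * q.coeff m := by
  rw [hallInner, powerSumExpansion_aeval, powerSumExpansion_aeval]

theorem zCoeff_mul_coeff_sum_cycleMonomial [CharZero K] {α : Type*} [Fintype α] [DecidableEq α]
    (L : MvPolynomial ℕ+ K →ₗ[K] K) {d : ℕ+ →₀ ℕ}
    (hd : Finsupp.weight PNat.val d = Fintype.card α) :
    zCoeff d * MvPolynomial.coeff d (((Fintype.card α).factorial : K)⁻¹ •
      ∑ π : Equiv.Perm α, L (cycleMonomial K π) • cycleMonomial K π) =
        L (MvPolynomial.monomial d 1) := by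
  obtain ⟨s, rfl⟩ : ∃ s, Multiset.toFinsupp s = d := ⟨_, Finsupp.toMultiset_toFinsupp d⟩
  have coeff_term (π : Equiv.Perm α) : MvPolynomial.coeff (Multiset.toFinsupp s)
      (L (cycleMonomial K π) • cycleMonomial K π) =
      if cycleLengths π = s then L (MvPolynomial.monomial (Multiset.toFinsupp s) 1) else 0 := by
    rw [MvPolynomial.coeff_smul, cycleMonomial_eq_monomial, MvPolynomial.coeff_monomial]
    by_cases h : cycleLengths π = s
    · rw [h, if_pos rfl, if_pos rfl, smul_eq_mul, mul_one]
    · rw [if_neg h, if_neg fun h' => h (Multiset.toFinsupp.injective h'), smul_zero]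
  have card_mul := card_cycleLengths_mul_zCoeff (hd ▸ (weight_val_toFinsupp s).symm)
  have factorial_ne_zero : ((Fintype.card α).factorial : K) ≠ 0 :=
    Nat.cast_ne_zero.2 (Nat.factorial_ne_zero _)
  rw [MvPolynomial.coeff_smul, MvPolynomial.coeff_sum, Finset.sum_congr rfl fun π _ => coeff_term π,
    ← Finset.sum_filter, Finset.sum_const, nsmul_eq_mul, smul_eq_mul, mul_left_comm,
    inv_mul_eq_iff_eq_mul₀ factorial_ne_zero, ← card_mul, Nat.cast_mul]
  ring

/-- A family of values `L (cycleMonomial K π)` depends on `π` only through its cycle type, like the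
character of a representation. -/
theorem hallInner_aeval_sum_cyclePowerSum [CharZero K] {n : ℕ} {e : MvPolynomial ℕ+ K}
    (he : MvPolynomial.IsWeightedHomogeneous PNat.val e n) (L : MvPolynomial ℕ+ K →ₗ[K] K) :
    hallInner (MvPolynomial.aeval (powerSum K) e) ((n.factorial : K)⁻¹ •
      ∑ π : Equiv.Perm (Fin n), L (cycleMonomial K π) • cyclePowerSum K π) = L e := by
  have sum_eq_aeval : (n.factorial : K)⁻¹ •
      ∑ π : Equiv.Perm (Fin n), L (cycleMonomial K π) • cyclePowerSum K π =
      MvPolynomial.aeval (powerSum K) ((n.factorial : K)⁻¹ • ∑ π : Equiv.Perm (Fin n),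
        L (cycleMonomial K π) • cycleMonomial K π) := by
    simp only [map_smul, map_sum, aeval_powerSum_cycleMonomial]
  rw [sum_eq_aeval, hallInner_aeval_powerSum]
  conv_rhs => rw [e.as_sum, map_sum]
  refine Finset.sum_congr rfl fun d hd => ?_
  have weight_eq := he (MvPolynomial.mem_support_iff.1 hd)
  have zCoeff_mul_coeff := zCoeff_mul_coeff_sum_cycleMonomial (α := Fin n) L
    (weight_eq.trans (Fintype.card_fin n).symm)
  rw [Fintype.card_fin] at zCoeff_mul_coeff
  rw [mul_right_comm, zCoeff_mul_coeff, mul_comm, ← smul_eq_mul, ← map_smul,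
    MvPolynomial.smul_monomial, smul_eq_mul, mul_one]

/-! ### Complete homogeneous symmetric functions in power sums -/

section

variable {α β : Type*} [Fintype α]

theorem map_univ_comp_perm (i : α → β) (τ : Equiv.Perm α) :
    Finset.univ.val.map (i ∘ τ) = Finset.univ.val.map i := by
  rw [← Multiset.map_map, Multiset.map_univ_val_equiv]

theorem exists_map_univ_eq {r : ℕ} {s : Multiset β} (hs : s.card = r) :
    ∃ i : Fin r → β, Finset.univ.val.map i = s := by
  subst hs
  induction s using Quotient.inductionOn with
  | h l => exact ⟨l.get, (Fin.univ_val_map _).trans (congrArg _ (List.ofFn_get l))⟩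

theorem exists_eq_comp_perm_of_map_univ_eq {i i' : α → β}
    (h : Finset.univ.val.map i = Finset.univ.val.map i') : ∃ τ : Equiv.Perm α, i = i' ∘ τ := by
  classical
  have card_fiber (f : α → β) (x : β) :
      Fintype.card {j // f j = x} = (Finset.univ.val.map f).count x := by
    rw [Fintype.card_subtype, Multiset.count_map]
    simp only [eq_comm]
    rfl
  let e (x : β) : {j // i j = x} ≃ {j // i' j = x} :=
    Fintype.equivOfCardEq (by rw [card_fiber, card_fiber, h])
  exact ⟨Equiv.ofFiberEquiv e, funext fun j => (Equiv.ofFiberEquiv_map e j).symm⟩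

variable [DecidableEq α] [DecidableEq β]

/-- Orbit-stabilizer for the action of the permutations on families: the families with a given
multiset of values form one orbit. -/
theorem sum_card_stabilizer [Fintype β] (i₀ : α → β) :
    ∑ i : α → β with Finset.univ.val.map i = Finset.univ.val.map i₀,
      Fintype.card {τ : Equiv.Perm α // i ∘ τ = i} = (Fintype.card α).factorial := by
  have h := Finset.card_eq_sum_card_fiberwise (f := fun τ : Equiv.Perm α => i₀ ∘ τ)
    (s := Finset.univ)
    (t := Finset.univ.filter fun i : α → β => Finset.univ.val.map i = Finset.univ.val.map i₀)
    fun τ _ => Finset.mem_filter.2 ⟨Finset.mem_univ _, map_univ_comp_perm i₀ τ⟩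
  rw [Finset.card_univ, Fintype.card_perm] at h
  rw [h]
  refine Finset.sum_congr rfl fun i hi => ?_
  obtain ⟨τ₀, rfl⟩ := exists_eq_comp_perm_of_map_univ_eq (Finset.mem_filter.1 hi).2
  rw [Fintype.card_subtype]
  refine Finset.card_bij (fun τ _ => τ₀ * τ) (fun τ hτ => ?_) (fun _ _ _ _ => mul_left_cancel)
    fun τ hτ => ⟨τ₀⁻¹ * τ, ?_, mul_inv_cancel_left _ _⟩
  · simpa [Function.comp_assoc] using hτ
  · refine Finset.mem_filter.2 ⟨Finset.mem_univ _, ?_⟩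
    rw [Function.comp_assoc, ← Equiv.Perm.coe_mul, mul_inv_cancel_left]
    exact (Finset.mem_filter.1 hτ).2

theorem cycleSum_diagonal {R : Type*} [CommSemiring R] [Fintype β] (a : β → R)
    (τ : Equiv.Perm α) :
    cycleSum (Matrix.diagonal a) τ = ∑ i : α → β with i ∘ τ = i, ∏ j, a (i j) := by
  rw [cycleSum, Finset.sum_filter]
  refine Finset.sum_congr rfl fun i _ => ?_
  split_ifs with h
  · exact Finset.prod_congr rfl fun j _ => by
      rw [show i (τ j) = i j from congrFun h j, Matrix.diagonal_apply_eq]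
  · obtain ⟨j, hj⟩ := Function.ne_iff.1 h
    exact Finset.prod_eq_zero (Finset.mem_univ j) (Matrix.diagonal_apply_ne _ hj)

theorem factorial_nsmul_hsymm (R : Type*) [CommSemiring R] [Fintype β] (r : ℕ) :
    r.factorial • MvPolynomial.hsymm β R r = ∑ τ : Equiv.Perm (Fin r),
      cycleSum (Matrix.diagonal (MvPolynomial.X : β → MvPolynomial β R)) τ := by
  let toSym (i : Fin r → β) : Sym β r := ⟨Finset.univ.val.map i, by simp⟩
  have sum_fiber (s : Sym β r) : ∑ i with toSym i = s,
      Fintype.card {τ : Equiv.Perm (Fin r) // i ∘ τ = i} • ∏ j, MvPolynomial.X (i j) =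
        r.factorial • (s.1.map (MvPolynomial.X (R := R))).prod := by
    obtain ⟨i₀, hi₀⟩ := exists_map_univ_eq s.2
    have toSym_eq_iff (i : Fin r → β) :
        toSym i = s ↔ Finset.univ.val.map i = Finset.univ.val.map i₀ := by
      rw [hi₀]
      exact Subtype.ext_iff
    have h := sum_card_stabilizer i₀
    rw [Fintype.card_fin] at h
    rw [← h, Finset.sum_smul]
    simp only [toSym_eq_iff]
    refine Finset.sum_congr rfl fun i hi => ?_
    rw [← hi₀, ← (Finset.mem_filter.1 hi).2, Multiset.map_map]
    rfl
  calc r.factorial • MvPolynomial.hsymm β R r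
      = ∑ s : Sym β r, r.factorial • (s.1.map (MvPolynomial.X (R := R))).prod := by
        rw [MvPolynomial.hsymm, Finset.smul_sum]
    _ = ∑ i : Fin r → β,
          Fintype.card {τ : Equiv.Perm (Fin r) // i ∘ τ = i} • ∏ j, MvPolynomial.X (i j) := by
        rw [← Finset.sum_fiberwise _ toSym]
        exact Finset.sum_congr rfl fun s _ => (sum_fiber s).symm
    _ = _ := by
        simp only [cycleSum_diagonal, Finset.sum_filter]
        rw [Finset.sum_comm]
        simp only [← Finset.sum_filter, Finset.sum_const, Fintype.card_subtype]

end

theorem trace_diagonal_pow {ι R : Type*} [Fintype ι] [DecidableEq ι] [CommSemiring R] (a : ι → R)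
    (m : ℕ) : Matrix.trace (Matrix.diagonal a ^ m) = ∑ i, a i ^ m := by
  simp only [Matrix.diagonal_pow, Matrix.trace_diagonal, Pi.pow_apply]

/-- The complete homogeneous symmetric function `h_r` as a polynomial in the power sums, where the
variable `X n` stands for `p_n`. -/
def completeHomogeneousPoly (K : Type u) [Field K] (r : ℕ) : MvPolynomial ℕ+ K :=
  (r.factorial : K)⁻¹ • ∑ τ : Equiv.Perm (Fin r), cycleMonomial K τ

theorem isWeightedHomogeneous_completeHomogeneousPoly (r : ℕ) :
    MvPolynomial.IsWeightedHomogeneous PNat.val (completeHomogeneousPoly K r) r := by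
  refine Submodule.smul_mem (MvPolynomial.weightedHomogeneousSubmodule K PNat.val r) _
    (Submodule.sum_mem _ fun τ _ => ?_)
  have h := isWeightedHomogeneous_cycleMonomial K τ
  rwa [Fintype.card_fin] at h

theorem completeHomogeneous_eq_aeval [CharZero K] (r : ℕ) : completeHomogeneous K r =
    MvPolynomial.aeval (powerSum K) (completeHomogeneousPoly K r) := by
  refine symFun_ext_restrictVars fun n => ?_
  have factorial_ne_zero : (r.factorial : K) ≠ 0 := Nat.cast_ne_zero.2 r.factorial_ne_zero
  have psum_eq_trace (m : ℕ+) : MvPolynomial.psum (Fin n) K m =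
      Matrix.trace (Matrix.diagonal MvPolynomial.X ^ (m : ℕ)) := (trace_diagonal_pow _ _).symm
  rw [restrictVars_completeHomogeneous, restrictVars_aeval_powerSum, completeHomogeneousPoly,
    map_smul, map_sum]
  simp only [psum_eq_trace, aeval_trace_pow_cycleMonomial]
  rw [← factorial_nsmul_hsymm, ← Nat.cast_smul_eq_nsmul K, inv_smul_smul₀ factorial_ne_zero]

/-! ### Polarization -/

section

variable {α R M N : Type*} [AddCommGroup M] [AddCommGroup N]

/-- Inclusion–exclusion over the maps `α → α` which miss a given set of values. -/
theorem sum_perm_comp_eq_sum_diagonal [Fintype α] [DecidableEq α] [CommRing R] [Module R M]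
    [Module R N] (φ : MultilinearMap R (fun _ : α => M) N) (x : α → M) :
    ∑ σ : Equiv.Perm α, φ (x ∘ σ) =
      ∑ s : Finset α, (-1 : ℤ) ^ s.card • φ fun _ => ∑ i ∈ sᶜ, x i := by
  let missing (i : α) : Finset (α → α) := {f | ∀ j, f j ≠ i}
  have inf_missing (s : Finset α) : s.inf missing = Fintype.piFinset fun _ => sᶜ := by
    ext f
    simp only [missing, Finset.mem_inf, Finset.mem_filter_univ, Fintype.mem_piFinset,
      Finset.mem_compl]
    exact ⟨fun h j hj => h _ hj j rfl, fun h i hi j hj => h j (hj ▸ hi)⟩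
  have mem_inf_missing_compl (f : α → α) :
      f ∈ Finset.univ.inf (fun i => (missing i)ᶜ) ↔ Function.Bijective f := by
    rw [← Finite.surjective_iff_bijective]
    simp [missing, Finset.mem_inf, Function.Surjective]
  have sum_perm_eq : ∑ σ : Equiv.Perm α, φ (x ∘ σ) =
      ∑ f ∈ Finset.univ.inf fun i => (missing i)ᶜ, φ (x ∘ f) :=
    Finset.sum_bij' (fun σ _ => σ)
      (fun f hf => Equiv.ofBijective f ((mem_inf_missing_compl f).1 hf))
      (fun σ _ => (mem_inf_missing_compl σ).2 σ.bijective) (fun _ _ => Finset.mem_univ _)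
      (fun _ _ => Equiv.ext fun _ => rfl) (fun _ _ => rfl) fun _ _ => rfl
  rw [sum_perm_eq, Finset.inclusion_exclusion_sum_inf_compl, Finset.powerset_univ]
  refine Finset.sum_congr rfl fun s _ => ?_
  rw [inf_missing, φ.map_sum_finset]
  rfl

variable [Module K M] [Module K N]

theorem multilinearMap_ext_diagonal [CharZero K] [Finite α]
    {φ ψ : MultilinearMap K (fun _ : α => M) N}
    (hφ : ∀ (σ : Equiv.Perm α) (x : α → M), φ (x ∘ σ) = φ x)
    (hψ : ∀ (σ : Equiv.Perm α) (x : α → M), ψ (x ∘ σ) = ψ x)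
    (h : ∀ x, (φ fun _ => x) = ψ fun _ => x) : φ = ψ := by
  classical
  cases nonempty_fintype α
  ext x
  have factorial_ne_zero : ((Fintype.card α).factorial : K) ≠ 0 :=
    Nat.cast_ne_zero.2 (Nat.factorial_ne_zero _)
  have nsmul_eq : (Fintype.card α).factorial • φ x = (Fintype.card α).factorial • ψ x := by
    simpa only [h, ← sum_perm_comp_eq_sum_diagonal, hφ, hψ, Finset.sum_const, Finset.card_univ,
      Fintype.card_perm] using sum_perm_comp_eq_sum_diagonal φ x
  rw [← Nat.cast_smul_eq_nsmul K, ← Nat.cast_smul_eq_nsmul K] at nsmul_eq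
  exact smul_right_injective N factorial_ne_zero nsmul_eq

variable [Fintype α] [DecidableEq α]

/-- The symmetric multilinear map with the same restriction to the diagonal, obtained by averaging
over the permutations of the arguments; it is of use in characteristic zero only. -/
def symmetrize (φ : MultilinearMap K (fun _ : α => M) N) : MultilinearMap K (fun _ : α => M) N :=
  ((Fintype.card α).factorial : K)⁻¹ • ∑ σ : Equiv.Perm α, φ.domDomCongr σ

theorem symmetrize_apply (φ : MultilinearMap K (fun _ : α => M) N) (x : α → M) :
    symmetrize φ x = ((Fintype.card α).factorial : K)⁻¹ • ∑ σ : Equiv.Perm α, φ (x ∘ σ) := by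
  rw [symmetrize, smul_apply, sum_apply]
  rfl

theorem symmetrize_comp_perm (φ : MultilinearMap K (fun _ : α => M) N) (τ : Equiv.Perm α)
    (x : α → M) : symmetrize φ (x ∘ τ) = symmetrize φ x := by
  rw [symmetrize_apply, symmetrize_apply,
    ← Equiv.sum_comp (Equiv.mulLeft τ) fun σ => φ (x ∘ σ)]
  rfl

theorem symmetrize_diagonal [CharZero K] (φ : MultilinearMap K (fun _ : α => M) N) (x : M) :
    (symmetrize φ fun _ => x) = φ fun _ => x := by
  have factorial_ne_zero : ((Fintype.card α).factorial : K) ≠ 0 :=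
    Nat.cast_ne_zero.2 (Nat.factorial_ne_zero _)
  have comp_perm (σ : Equiv.Perm α) : φ ((fun _ => x) ∘ σ) = φ fun _ => x := rfl
  simp only [symmetrize_apply, comp_perm, Finset.sum_const, Finset.card_univ, Fintype.card_perm,
    ← Nat.cast_smul_eq_nsmul K, inv_smul_smul₀ factorial_ne_zero]

end

/-! ### Evaluation at the power sums of the eigenvalues of an endomorphism -/

section

variable {V W : Type*} [AddCommGroup V] [Module K V] [AddCommGroup W] [Module K W]

/-- The value at an endomorphism `A` of a polynomial in the power sums, where the power sum `p_m`,
represented by the variable `X m`, takes the value `Tr Aᵐ`. -/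
def traceEval (A : V →ₗ[K] V) : MvPolynomial ℕ+ K →ₐ[K] K :=
  MvPolynomial.aeval fun m : ℕ+ => LinearMap.trace K V (A ^ (m : ℕ))

theorem traceEval_eq_aeval_toMatrix {ι : Type*} [Fintype ι] [DecidableEq ι]
    (b : Module.Basis ι K V) (A : V →ₗ[K] V) : traceEval A =
      MvPolynomial.aeval fun m : ℕ+ => Matrix.trace (LinearMap.toMatrix b b A ^ (m : ℕ)) := by
  simp only [traceEval, LinearMap.trace_eq_matrix_trace K b, LinearMap.toMatrix_pow]

theorem traceEval_cycleMonomial {α ι : Type*} [Fintype α] [DecidableEq α] [Fintype ι]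
    [DecidableEq ι] (b : Module.Basis ι K V) (A : V →ₗ[K] V) (π : Equiv.Perm α) :
    traceEval A (cycleMonomial K π) = cycleSum (LinearMap.toMatrix b b A) π := by
  rw [traceEval_eq_aeval_toMatrix b, aeval_trace_pow_cycleMonomial]

theorem traceEval_toLin'_diagonal (q : MvPolynomial ℕ+ K) {n : ℕ} (a : Fin n → K) :
    traceEval (Matrix.toLin' (Matrix.diagonal a)) q =
      evalFin (MvPolynomial.aeval (powerSum K) q) a := by
  simp only [traceEval, ← Matrix.toLin'_pow, Matrix.trace_toLin'_eq, trace_diagonal_pow,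
    evalFin_aeval_powerSum, MvPolynomial.aeval_eq_eval]

theorem traceEval_plethysmPoly {A : V →ₗ[K] V} {B : W →ₗ[K] W} (p : MvPolynomial ℕ+ K)
    {q : MvPolynomial ℕ+ K} (h : ∀ n : ℕ, LinearMap.trace K W (B ^ n) = traceEval (A ^ n) q) :
    traceEval A (plethysmPoly p q) = traceEval B p := by
  rw [plethysmPoly, ← AlgHom.comp_apply, MvPolynomial.comp_aeval, traceEval, traceEval]
  congr 2
  funext n
  rw [h, MvPolynomial.aeval_rename, traceEval]
  simp only [Function.comp_def, PNat.mul_coe, pow_mul]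

end

/-! ### Polynomial functors -/

section functor

variable {k : ℕ} {P : FGModuleCat.{u} K ⥤ FGModuleCat.{u} K} {U W Z : Type u} [AddCommGroup U]
  [Module K U] [Module.Finite K U] [AddCommGroup W] [Module K W] [Module.Finite K W]
  [AddCommGroup Z] [Module K Z] [Module.Finite K Z]

theorem functorMap_comp (P : FGModuleCat.{u} K ⥤ FGModuleCat.{u} K) (g : W →ₗ[K] Z)
    (f : U →ₗ[K] W) : functorMap P (g ∘ₗ f) = functorMap P g ∘ₗ functorMap P f :=
  congrArg (fun f => f.hom.hom) (P.map_comp (FGModuleCat.ofHom f) (FGModuleCat.ofHom g))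

theorem functorMap_pow (P : FGModuleCat.{u} K ⥤ FGModuleCat.{u} K) (A : W →ₗ[K] W) (n : ℕ) :
    functorMap P (A ^ n) = functorMap P A ^ n := by
  induction n with
  | zero => exact congrArg (fun f => f.hom.hom) (P.map_id (FGModuleCat.of K W))
  | succ n ih => rw [pow_succ, pow_succ, ← ih]; exact functorMap_comp P (A ^ n) A

variable (hP : IsHomogeneousPolynomialFunctor k P)

/-- The polarization of `P`: the symmetric multilinear map with `f ↦ P(f)` as its restriction to the
diagonal. -/
def polar (U W : Type u) [AddCommGroup U] [Module K U] [Module.Finite K U] [AddCommGroup W]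
    [Module K W] [Module.Finite K W] : MultilinearMap K (fun _ : Fin k => U →ₗ[K] W)
      (P.obj (FGModuleCat.of K U) →ₗ[K] P.obj (FGModuleCat.of K W)) :=
  symmetrize (hP U W).choose

theorem polar_comp_perm (σ : Equiv.Perm (Fin k)) (a : Fin k → U →ₗ[K] W) :
    polar hP U W (a ∘ σ) = polar hP U W a :=
  symmetrize_comp_perm _ _ _

/-- The trace of the polarization of `P` at the matrix units `E i (σ i)` of `K^k`. -/
def permTrace (σ : Equiv.Perm (Fin k)) : K :=
  LinearMap.trace K _ (polar hP (Fin k → K) (Fin k → K) fun i =>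
    (LinearMap.proj (σ i) : (Fin k → K) →ₗ[K] K).smulRight (Pi.single i 1))

/-- The character of `P` as a polynomial in the power sums, where the variable `X n` stands for
`p_n`. -/
def characterPoly : MvPolynomial ℕ+ K :=
  ∑ σ : Equiv.Perm (Fin k), permTrace hP σ • cycleMonomial K σ⁻¹

theorem isWeightedHomogeneous_characterPoly :
    MvPolynomial.IsWeightedHomogeneous PNat.val (characterPoly hP) k := by
  refine Submodule.sum_mem (MvPolynomial.weightedHomogeneousSubmodule K PNat.val k)
    fun σ _ => Submodule.smul_mem _ _ ?_
  have h := isWeightedHomogeneous_cycleMonomial K σ⁻¹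
  rwa [Fintype.card_fin] at h

variable [CharZero K]

theorem polar_diagonal (f : U →ₗ[K] W) : (polar hP U W fun _ => f) = functorMap P f :=
  (symmetrize_diagonal _ f).trans ((hP U W).choose_spec f).symm

theorem polar_comp_functorMap (a : Fin k → W →ₗ[K] Z) (b : U →ₗ[K] W) :
    polar hP W Z a ∘ₗ functorMap P b = polar hP U Z fun i => a i ∘ₗ b := by
  have h : (LinearMap.lcomp K _ (functorMap P b)).compMultilinearMap (polar hP W Z) =
      (polar hP U Z).compLinearMap fun _ => LinearMap.lcomp K Z b := by
    refine multilinearMap_ext_diagonal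
      (fun σ x => congrArg (· ∘ₗ functorMap P b) (polar_comp_perm hP σ x))
      (fun σ x => polar_comp_perm hP σ fun i => x i ∘ₗ b) fun x => ?_
    rw [LinearMap.compMultilinearMap_apply, MultilinearMap.compLinearMap_apply, polar_diagonal,
      polar_diagonal]
    exact (functorMap_comp P x b).symm
  exact DFunLike.congr_fun h a

theorem polar_comp_polar (a : Fin k → W →ₗ[K] Z) (b : Fin k → U →ₗ[K] W) :
    polar hP W Z a ∘ₗ polar hP U W b =
      (k.factorial : K)⁻¹ • ∑ σ : Equiv.Perm (Fin k), polar hP U Z fun i => a i ∘ₗ b (σ i) := by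
  have h : (LinearMap.llcomp K _ _ _ (polar hP W Z a)).compMultilinearMap (polar hP U W) =
      symmetrize ((polar hP U Z).compLinearMap fun i => LinearMap.llcomp K U W Z (a i)) := by
    refine multilinearMap_ext_diagonal
      (fun σ x => congrArg (polar hP W Z a ∘ₗ ·) (polar_comp_perm hP σ x))
      (fun σ x => symmetrize_comp_perm _ _ _) fun x => ?_
    rw [LinearMap.compMultilinearMap_apply, symmetrize_diagonal,
      MultilinearMap.compLinearMap_apply, polar_diagonal]
    exact polar_comp_functorMap hP a x
  have h_apply := DFunLike.congr_fun h b
  rw [symmetrize_apply, Fintype.card_fin] at h_apply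
  exact h_apply

theorem sum_trace_polar_comp_comm (a : Fin k → U →ₗ[K] W) (b : Fin k → W →ₗ[K] U) :
    ∑ σ : Equiv.Perm (Fin k), LinearMap.trace K _ (polar hP W W fun i => a i ∘ₗ b (σ i)) =
      ∑ σ : Equiv.Perm (Fin k), LinearMap.trace K _ (polar hP U U fun i => b i ∘ₗ a (σ i)) := by
  have factorial_ne_zero : (k.factorial : K) ≠ 0 := Nat.cast_ne_zero.2 k.factorial_ne_zero
  have h := LinearMap.trace_comp_comm' (polar hP U W a) (polar hP W U b)
  rw [polar_comp_polar, polar_comp_polar, map_smul, map_smul, map_sum, map_sum] at h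
  exact (smul_right_injective K (inv_ne_zero factorial_ne_zero) h).symm

/-- The operators of rank one factor as `a i ∘ b i` through `K^k` in such a way that
`a i ∘ b j = 0` for `i ≠ j`. -/
theorem trace_polar_smulRight (ξ : Fin k → Module.Dual K W) (w : Fin k → W) :
    LinearMap.trace K _ (polar hP W W fun i => (ξ i).smulRight (w i)) =
      ∑ σ : Equiv.Perm (Fin k), (∏ i, ξ i (w (σ i))) * permTrace hP σ := by
  let a (i : Fin k) : (Fin k → K) →ₗ[K] W := (LinearMap.proj i).smulRight (w i)
  let b (i : Fin k) : W →ₗ[K] Fin k → K := (ξ i).smulRight (Pi.single i 1)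
  have comp_self (i : Fin k) : a i ∘ₗ b i = (ξ i).smulRight (w i) := by
    ext x
    simp [a, b]
  have comp_of_ne {i j : Fin k} (h : i ≠ j) : a i ∘ₗ b j = 0 := by
    ext x
    simp [a, b, Pi.single_eq_of_ne h]
  have comp_comm (i j : Fin k) : b i ∘ₗ a j = ξ i (w j) •
      (LinearMap.proj j : (Fin k → K) →ₗ[K] K).smulRight (Pi.single i 1) := by
    refine LinearMap.ext fun x => ?_
    simp [a, b, smul_smul, mul_comm]
  have h := sum_trace_polar_comp_comm hP a b
  rw [Fintype.sum_eq_single 1] at h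
  · simp only [comp_comm, Equiv.Perm.one_apply, comp_self, MultilinearMap.map_smul_univ, map_smul,
      smul_eq_mul] at h
    exact h
  · intro σ hσ
    obtain ⟨i, hi⟩ : ∃ i, σ i ≠ i := not_forall.1 fun h => hσ (Equiv.ext h)
    rw [MultilinearMap.map_coord_zero _ i (comp_of_ne hi.symm), map_zero]

theorem trace_functorMap (A : W →ₗ[K] W) :
    LinearMap.trace K _ (functorMap P A) = traceEval A (characterPoly hP) := by
  classical
  let b := Module.Free.chooseBasis K W
  have eq_sum : A = ∑ j, (b.coord j).smulRight (A (b j)) := b.ext fun j => by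
    simp [LinearMap.sum_apply, Finsupp.single_apply]
  calc LinearMap.trace K _ (functorMap P A)
      = ∑ x : Fin k → Module.Free.ChooseBasisIndex K W, LinearMap.trace K _ (polar hP W W fun i =>
          (b.coord (x i)).smulRight (A (b (x i)))) := by
        rw [← polar_diagonal hP]
        conv_lhs => rw [eq_sum]
        rw [MultilinearMap.map_sum, map_sum]
    _ = ∑ σ : Equiv.Perm (Fin k), permTrace hP σ * traceEval A (cycleMonomial K σ⁻¹) := by
        simp only [trace_polar_smulRight, traceEval_cycleMonomial b, cycleSum_inv, Finset.mul_sum]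
        rw [Finset.sum_comm]
        simp only [mul_comm, LinearMap.toMatrix_apply, Module.Basis.coord_apply]
    _ = traceEval A (characterPoly hP) := by
        rw [characterPoly, map_sum]
        simp only [map_smul, smul_eq_mul]

theorem isCharacter_aeval_characterPoly :
    IsCharacter P (MvPolynomial.aeval (powerSum K) (characterPoly hP)) := fun n a => by
  rw [trace_functorMap hP, traceEval_toLin'_diagonal]

theorem IsCharacter.unique {F F' : SymFun K} (hF : IsCharacter P F) (hF' : IsCharacter P F') :
    F = F' :=
  symFun_ext_evalFin fun n a => (hF n a).trans (hF' n a).symm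

include hP in
theorem existsUnique_isCharacter : ∃! F : SymFun K, IsCharacter P F :=
  ⟨_, isCharacter_aeval_characterPoly hP,
    fun _ hF => hF.unique (isCharacter_aeval_characterPoly hP)⟩

include hP in
theorem isCharacter_character : IsCharacter P (character P) :=
  Classical.epsilon_spec (existsUnique_isCharacter hP).exists

theorem character_eq_aeval :
    character P = MvPolynomial.aeval (powerSum K) (characterPoly hP) :=
  (isCharacter_character hP).unique (isCharacter_aeval_characterPoly hP)

theorem plethysm_completeHomogeneous_character (r : ℕ) :
    plethysm (completeHomogeneous K r) (character P) = MvPolynomial.aeval (powerSum K)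
      (plethysmPoly (completeHomogeneousPoly K r) (characterPoly hP)) := by
  rw [completeHomogeneous_eq_aeval, character_eq_aeval hP, plethysm_aeval]

theorem traceEval_plethysmPoly_characterPoly (p : MvPolynomial ℕ+ K) (A : W →ₗ[K] W) :
    traceEval A (plethysmPoly p (characterPoly hP)) = traceEval (functorMap P A) p :=
  traceEval_plethysmPoly p fun n => by rw [← functorMap_pow, trace_functorMap hP]

end functor

/-! ### Rational representations -/

section rational

variable {G : Type v} [Group G] [AffineAlgebraicGroup K G] {M N : Type*} [AddCommGroup M]
  [Module K M] [AddCommGroup N] [Module K N]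

/-- A map from an algebraic group to a vector space is regular if its composition with each linear
form is a regular function. For the map `g ↦ ρ g` of a finite dimensional representation this says
that `ρ` is rational. -/
def IsRegularMap (f : G → N) : Prop :=
  ∀ ψ : Module.Dual K N, (fun g => ψ (f g)) ∈ AffineAlgebraicGroup.regular (K := K) (G := G)

theorem isRegularMap_const (y : N) : IsRegularMap (K := K) fun _ : G => y := fun ψ =>
  (AffineAlgebraicGroup.regular (K := K) (G := G)).algebraMap_mem (ψ y)

theorem IsRegularMap.linear {f : G → M} (hf : IsRegularMap (K := K) f) (L : M →ₗ[K] N) :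
    IsRegularMap (K := K) fun g => L (f g) :=
  fun ψ => hf (ψ ∘ₗ L)

theorem IsRegularMap.prodMk {f : G → M} {f' : G → N} (hf : IsRegularMap (K := K) f)
    (hf' : IsRegularMap (K := K) f') : IsRegularMap (K := K) fun g => (f g, f' g) := by
  intro ψ
  have h := add_mem (hf (ψ ∘ₗ LinearMap.inl K M N)) (hf' (ψ ∘ₗ LinearMap.inr K M N))
  convert h using 1
  funext g
  simp [← map_add]

theorem IsRegularMap.multilinear [FiniteDimensional K M] {ι : Type*} [Finite ι] {f : G → M}
    (hf : IsRegularMap (K := K) f) (φ : MultilinearMap K (fun _ : ι => M) N) :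
    IsRegularMap (K := K) fun g => φ fun _ => f g := by
  classical
  have := Fintype.ofFinite ι
  intro ψ
  let b := Module.Free.chooseBasis K M
  have eq_sum : (fun g => ψ (φ fun _ => f g)) =
      ∑ x : ι → Module.Free.ChooseBasisIndex K M,
        ψ (φ fun i => b (x i)) • ∏ i, fun g => b.coord (x i) (f g) := by
    funext g
    conv_lhs => rw [← b.sum_repr (f g), MultilinearMap.map_sum, map_sum]
    simp only [MultilinearMap.map_smul_univ, map_smul, Finset.sum_apply, Pi.smul_apply,
      Finset.prod_apply, smul_eq_mul, Module.Basis.coord_apply, mul_comm]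
  rw [eq_sum]
  exact sum_mem fun x _ => Subalgebra.smul_mem _ (prod_mem fun i _ => hf _) _

theorem IsRegularMap.isRational {ρ : Representation K G N}
    (h : IsRegularMap (K := K) fun g => ρ g) : IsRational ρ :=
  fun w φ => h (φ ∘ₗ LinearMap.applyₗ w)

theorem IsRational.isRegularMap [FiniteDimensional K N] {ρ : Representation K G N}
    (h : IsRational ρ) : IsRegularMap (K := K) fun g => ρ g := by
  intro ψ
  let b := Module.Free.chooseBasis K N
  have eq_sum : (fun g => ψ (ρ g)) = ∑ j, fun g =>
      (ψ ∘ₗ LinearMap.smulRightₗ (b.coord j)) (ρ g (b j)) := by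
    funext g
    have eq_sum_smulRight : ρ g = ∑ j, (b.coord j).smulRight (ρ g (b j)) := b.ext fun j => by
      classical
      simp [LinearMap.sum_apply, Finsupp.single_apply]
    conv_lhs => rw [eq_sum_smulRight, map_sum]
    rw [Finset.sum_apply]
    rfl
  rw [eq_sum]
  exact sum_mem fun j _ => h _ _

theorem IsRational.prod [FiniteDimensional K M] [FiniteDimensional K N]
    {ρ : Representation K G M} {σ : Representation K G N} (hρ : IsRational ρ)
    (hσ : IsRational σ) : IsRational (ρ.prod σ) :=
  IsRegularMap.isRational <|
    (hρ.isRegularMap.prodMk hσ.isRegularMap).linear (LinearMap.prodMapLinear K M N M N K)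

theorem isRational_trivial : IsRational (Representation.trivial K G N) :=
  (isRegularMap_const (LinearMap.id : N →ₗ[K] N)).isRational

theorem IsRational.linHom_trivial [FiniteDimensional K N] {ρ : Representation K G N}
    (hρ : IsRational ρ) : IsRational ((Representation.trivial K G M).linHom ρ) :=
  (hρ.isRegularMap.linear (LinearMap.llcomp K M N N)).isRational

end rational

/-! ### Reynolds operators -/

section reynolds

open Representation

variable {G : Type v} [Group G] {M N : Type*} [AddCommGroup M] [Module K M] [AddCommGroup N]
  [Module K N]

theorem map_asAlgebraHom_of_intertwiningMap {ρ : Representation K G M} {σ : Representation K G N}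
    (f : IntertwiningMap ρ σ) (c : MonoidAlgebra K G) (x : M) :
    f (ρ.asAlgebraHom c x) = σ.asAlgebraHom c (f x) := by
  induction c using MonoidAlgebra.induction_linear with
  | zero => simp
  | add c d hc hd => simp [hc, hd]
  | single g a => simp [f.isIntertwining]

theorem map_asAlgebraHom (ρ : Representation K G M) (c : MonoidAlgebra K G)
    (L : (M →ₗ[K] M) →ₗ[K] N) :
    L (ρ.asAlgebraHom c) = Finsupp.linearCombination K (fun g => L (ρ g)) c.coeff := by
  induction c using MonoidAlgebra.induction_linear with
  | zero => simp
  | add c d hc hd => simp [hc, hd]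
  | single g a => simp

/-- An element of the group algebra, with sum of coefficients one, which is absorbed by the group in
a representation on both sides. It acts as a projection onto the invariants. -/
structure IsReynolds (ρ : Representation K G M) (c : MonoidAlgebra K G) : Prop where
  augmentation : (trivial K G K).asAlgebraHom c = 1
  rho_comp : ∀ g, ρ g ∘ₗ ρ.asAlgebraHom c = ρ.asAlgebraHom c
  comp_rho : ∀ g, ρ.asAlgebraHom c ∘ₗ ρ g = ρ.asAlgebraHom c

theorem asAlgebraHom_apply_of_mem_invariants {ρ : Representation K G M} {c : MonoidAlgebra K G}
    (hc : (trivial K G K).asAlgebraHom c = 1) {x : M} (hx : x ∈ ρ.invariants) :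
    ρ.asAlgebraHom c x = x := by
  let f : IntertwiningMap (trivial K G K) ρ :=
    (LinearMap.toSpanSingleton K M x).intertwiningMap_of_isIntertwiningMap _ _
      fun g a => by simp [hx g]
  have h := map_asAlgebraHom_of_intertwiningMap f c 1
  rw [hc] at h
  simpa [f] using h.symm

theorem IsReynolds.isProj {ρ : Representation K G M} {c : MonoidAlgebra K G}
    (h : IsReynolds ρ c) : LinearMap.IsProj ρ.invariants (ρ.asAlgebraHom c) where
  map_mem x g := LinearMap.congr_fun (h.rho_comp g) x
  map_id _ hx := asAlgebraHom_apply_of_mem_invariants h.augmentation hx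

theorem IsReynolds.isProj_dual {ρ : Representation K G M} {c : MonoidAlgebra K G}
    (h : IsReynolds ρ c) :
    LinearMap.IsProj ρ.dual.invariants (Module.Dual.transpose (R := K) (ρ.asAlgebraHom c)) where
  map_mem φ g := LinearMap.ext fun x => congrArg φ (LinearMap.congr_fun (h.comp_rho g⁻¹) x)
  map_id φ hφ := by
    let f : IntertwiningMap ρ (trivial K G K) := φ.intertwiningMap_of_isIntertwiningMap _ _
      fun g x => by
        have h := LinearMap.congr_fun (hφ g⁻¹) x
        rwa [dual_apply, inv_inv] at h
    refine LinearMap.ext fun x => ?_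
    have h_map := map_asAlgebraHom_of_intertwiningMap f c x
    rw [h.augmentation] at h_map
    exact h_map

theorem IsReynolds.of_intertwiningMap_surjective {ρ : Representation K G M}
    {σ : Representation K G N} {c : MonoidAlgebra K G} (h : IsReynolds ρ c)
    (f : IntertwiningMap ρ σ) (hf : Function.Surjective f) : IsReynolds σ c where
  augmentation := h.augmentation
  rho_comp g := LinearMap.ext <| hf.forall.2 fun x => by
    rw [LinearMap.comp_apply, ← map_asAlgebraHom_of_intertwiningMap, ← f.isIntertwining,
      ← LinearMap.comp_apply, h.rho_comp]
  comp_rho g := LinearMap.ext <| hf.forall.2 fun x => by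
    rw [LinearMap.comp_apply, ← f.isIntertwining, ← map_asAlgebraHom_of_intertwiningMap,
      ← map_asAlgebraHom_of_intertwiningMap, ← LinearMap.comp_apply, h.comp_rho]

theorem isCompl_toSubmodule {ρ : Representation K G M} {σ τ : Subrepresentation ρ}
    (h : IsCompl σ τ) : IsCompl σ.toSubmodule τ.toSubmodule := by
  refine IsCompl.of_eq ?_ ?_
  · rw [← Subrepresentation.toSubmodule_inf, h.inf_eq_bot]
    rfl
  · rw [← Subrepresentation.toSubmodule_sup, h.sup_eq_top]
    rfl

/-- The element sought is the component of `x` in a complement, within its orbit under the group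
algebra, of the kernel of `f`. -/
theorem exists_asAlgebraHom_apply_mem_invariants {τ : Representation K G M}
    [IsSemisimpleRepresentation τ] (f : IntertwiningMap τ (trivial K G K)) {x : M} (hx : f x = 1) :
    ∃ c : MonoidAlgebra K G, τ.asAlgebraHom c x ∈ τ.invariants ∧ f (τ.asAlgebraHom c x) = 1 := by
  let orbit : Subrepresentation τ :=
    { toSubmodule := LinearMap.range (LinearMap.applyₗ x ∘ₗ τ.asAlgebraHom.toLinearMap)
      apply_mem_toSubmodule := by
        rintro g _ ⟨c, rfl⟩
        exact ⟨MonoidAlgebra.single g 1 * c, by simp⟩ }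
  obtain ⟨J, hJ⟩ := exists_isCompl (orbit ⊓ f.ker)
  have h_compl := isCompl_toSubmodule hJ
  obtain ⟨_, ⟨⟨c, rfl⟩, hc⟩, j, hj, hxj⟩ :=
    Submodule.mem_sup.1 (h_compl.sup_eq_top ▸ Submodule.mem_top (x := x))
  have j_eq : τ.asAlgebraHom (1 - c) x = j := by
    rw [map_sub, map_one, LinearMap.sub_apply, Module.End.one_apply, sub_eq_iff_eq_add']
    exact hxj.symm
  have f_j : f j = 1 := by
    rw [← hx, ← hxj, map_add]
    exact (add_eq_right.2 hc).symm
  refine ⟨1 - c, fun g => ?_, j_eq ▸ f_j⟩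
  rw [← sub_eq_zero, ← Submodule.mem_bot K, ← h_compl.inf_eq_bot, j_eq]
  have hj_orbit : j ∈ orbit.toSubmodule := ⟨1 - c, j_eq⟩
  refine ⟨⟨sub_mem (orbit.apply_mem_toSubmodule g hj_orbit) hj_orbit, ?_⟩,
    sub_mem (J.apply_mem_toSubmodule g hj) hj⟩
  change f (τ g j - j) = 0
  rw [map_sub, f.isIntertwining, trivial_apply, sub_self]

/-- An invariant complement `J` of the invariants is mapped both into `J` and into the invariants,
hence to zero. -/
theorem IsReynolds.of_rho_comp {ρ : Representation K G M} [IsSemisimpleRepresentation ρ]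
    {c : MonoidAlgebra K G} (augmentation : (trivial K G K).asAlgebraHom c = 1)
    (rho_comp : ∀ g, ρ g ∘ₗ ρ.asAlgebraHom c = ρ.asAlgebraHom c) : IsReynolds ρ c := by
  refine ⟨augmentation, rho_comp, fun g => ?_⟩
  have map_mem (x : M) : ρ.asAlgebraHom c x ∈ ρ.invariants :=
    fun g => LinearMap.congr_fun (rho_comp g) x
  let I : Subrepresentation ρ := ⟨ρ.invariants, fun g x hx => by rwa [hx g]⟩
  obtain ⟨J, hJ⟩ := exists_isCompl I
  have h_compl : IsCompl ρ.invariants J.toSubmodule := isCompl_toSubmodule hJ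
  have eq_zero_of_mem {x : M} (hx : x ∈ J.toSubmodule) : ρ.asAlgebraHom c x = 0 := by
    rw [← Submodule.mem_bot K, ← h_compl.inf_eq_bot]
    exact ⟨map_mem x, ρ.asAlgebraHom_mem_of_forall_mem J.toSubmodule
      (fun g _ hy => J.apply_mem_toSubmodule g hy) x hx c⟩
  refine LinearMap.ext fun x => ?_
  obtain ⟨y, hy, z, hz, rfl⟩ :=
    Submodule.mem_sup.1 (h_compl.sup_eq_top ▸ Submodule.mem_top (x := x))
  rw [LinearMap.comp_apply, map_add, map_add, map_add, hy g, eq_zero_of_mem hz,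
    eq_zero_of_mem (J.apply_mem_toSubmodule g hz)]

/-- With `G` acting on `End N × K` by left multiplication on `End N` and trivially on `K`, the
element sought is one that makes `(1, 1)` invariant without changing its second component. -/
theorem IsReductive.exists_isReynolds [AffineAlgebraicGroup K G] (hG : IsReductive K G)
    {N : Type u} [AddCommGroup N] [Module K N] [FiniteDimensional K N] {ρ : Representation K G N}
    (hρ : IsRational ρ) : ∃ c : MonoidAlgebra K G, IsReynolds ρ c := by
  let σ := (trivial K G N).linHom ρ
  let τ := σ.prod (trivial K G K)
  let evalAt (x : N) : IntertwiningMap σ ρ :=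
    (LinearMap.applyₗ x).intertwiningMap_of_isIntertwiningMap _ _ fun _ _ => rfl
  have : IsSemisimpleRepresentation τ := hG _ _ (hρ.linHom_trivial.prod isRational_trivial)
  have : IsSemisimpleRepresentation ρ := hG _ _ hρ
  obtain ⟨c, c_mem, hc⟩ :=
    exists_asAlgebraHom_apply_mem_invariants (IntertwiningMap.snd K σ (trivial K G K))
      (x := (1, 1)) rfl
  have fst_eq : (τ.asAlgebraHom c (1, 1)).1 = ρ.asAlgebraHom c := LinearMap.ext fun x =>
    map_asAlgebraHom_of_intertwiningMap
      ((evalAt x).comp (IntertwiningMap.fst K σ (trivial K G K))) c (1, 1)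
  refine ⟨c, IsReynolds.of_rho_comp (LinearMap.ext_ring ?_) fun g => ?_⟩
  · rw [map_asAlgebraHom_of_intertwiningMap] at hc
    exact hc
  · rw [← fst_eq]
    exact congrArg Prod.fst (c_mem g)

end reynolds

/-! ### Invariants of tensor powers and invariant polynomials -/

open scoped TensorProduct

section projection

variable {R M : Type*} [CommRing R] [AddCommGroup M] [Module R M]

theorem isProj_inf_comp {p q : Submodule R M} {e f : M →ₗ[R] M} (he : LinearMap.IsProj p e)
    (hf : LinearMap.IsProj q f) (comm : ∀ x, e (f x) = f (e x)) :
    LinearMap.IsProj (p ⊓ q) (e ∘ₗ f) where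
  map_mem x := ⟨he.map_mem _, by rw [LinearMap.comp_apply, comm]; exact hf.map_mem _⟩
  map_id x hx := by rw [LinearMap.comp_apply, hf.map_id x hx.2, he.map_id x hx.1]

theorem trace_eq_trace_comp_of_isProj [Module.Free R M] [Module.Finite R M] {p : Submodule R M}
    [Module.Free R p] [Module.Finite R p] {e f : M →ₗ[R] M} (he : LinearMap.IsProj p e)
    {f' : p →ₗ[R] p} (hf : ∀ x, (f' x : M) = f x) :
    LinearMap.trace R p f' = LinearMap.trace R M (f ∘ₗ e) := by
  have f_comp_e : f ∘ₗ e = p.subtype ∘ₗ f' ∘ₗ he.codRestrict :=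
    LinearMap.ext fun x => by simp [hf]
  have f'_eq : (f' ∘ₗ he.codRestrict) ∘ₗ p.subtype = f' :=
    LinearMap.ext fun x => congrArg f' (he.codRestrict_apply_cod x)
  rw [f_comp_e, LinearMap.trace_comp_comm' (f' ∘ₗ he.codRestrict) p.subtype, f'_eq]

end projection

theorem mem_invariants_dual_iff {G M : Type*} [Group G] [AddCommGroup M] [Module K M]
    {ρ : Representation K G M} {φ : Module.Dual K M} :
    φ ∈ ρ.dual.invariants ↔ ∀ g x, φ (ρ g x) = φ x := by
  rw [Representation.mem_invariants, ← (Equiv.inv G).forall_congr_right]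
  simp only [Representation.dual_apply, Equiv.inv_apply, inv_inv, LinearMap.ext_iff]
  rfl

section tensor

variable {G : Type v} [Group G] {V : Type*} [AddCommGroup V] [Module K V]
  (ρ : Representation K G V) {n : ℕ}

theorem permRep_tprod (π : Equiv.Perm (Fin n)) (x : Fin n → V) :
    permRep K V n π (PiTensorProduct.tprod K x) = PiTensorProduct.tprod K (x ∘ π.symm) :=
  PiTensorProduct.reindex_tprod π x

theorem tensorRep_tprod (g : G) (x : Fin n → V) :
    tensorRep ρ n g (PiTensorProduct.tprod K x) = PiTensorProduct.tprod K fun j => ρ g (x j) :=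
  PiTensorProduct.map_tprod _ _

theorem trace_permRep_comp_map [FiniteDimensional K V] (π : Equiv.Perm (Fin n)) (A : V →ₗ[K] V) :
    LinearMap.trace K _ (permRep K V n π ∘ₗ PiTensorProduct.map fun _ => A) =
      traceEval A (cycleMonomial K π) := by
  classical
  let b := Module.Free.chooseBasis K V
  rw [traceEval_cycleMonomial b, cycleSum,
    LinearMap.trace_eq_matrix_trace K (Basis.piTensorProduct fun _ : Fin n => b), Matrix.trace]
  refine Finset.sum_congr rfl fun i _ => ?_
  rw [Matrix.diag_apply, LinearMap.toMatrix_apply, Basis.piTensorProduct_apply,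
    LinearMap.comp_apply, PiTensorProduct.map_tprod, permRep_tprod,
    Basis.piTensorProduct_repr_tprod_apply, ← Equiv.prod_comp π]
  simp [LinearMap.toMatrix_apply]

/-- The combination of the evaluations `traceEval (ρ g)` with the coefficients of an element of the
group algebra. -/
def averageTraceEval (c : MonoidAlgebra K G) : MvPolynomial ℕ+ K →ₗ[K] K :=
  Finsupp.linearCombination K (fun g => (traceEval (ρ g)).toLinearMap) c.coeff

theorem averageTraceEval_apply (c : MonoidAlgebra K G) (q : MvPolynomial ℕ+ K) :
    averageTraceEval ρ c q = Finsupp.linearCombination K (fun g => traceEval (ρ g) q) c.coeff :=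
  Finsupp.apply_linearCombination K (LinearMap.applyₗ q) _ c.coeff

theorem trace_permRep_comp_asAlgebraHom [FiniteDimensional K V] (c : MonoidAlgebra K G)
    (π : Equiv.Perm (Fin n)) :
    LinearMap.trace K _ (permRep K V n π ∘ₗ (tensorRep ρ n).asAlgebraHom c) =
      averageTraceEval ρ c (cycleMonomial K π) := by
  rw [averageTraceEval_apply]
  simp only [← trace_permRep_comp_map]
  exact map_asAlgebraHom (tensorRep ρ n) c
    (LinearMap.trace K _ ∘ₗ LinearMap.llcomp K _ _ _ (permRep K V n π))

theorem trace_tensorInvariants [FiniteDimensional K V] {c : MonoidAlgebra K G}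
    (h : IsReynolds (tensorRep ρ n) c) (π : Equiv.Perm (Fin n)) :
    LinearMap.trace K _ ((tensorInvariants ρ n).toRepresentation π) =
      averageTraceEval ρ c (cycleMonomial K π) := by
  rw [← trace_permRep_comp_asAlgebraHom]
  exact trace_eq_trace_comp_of_isProj h.isProj fun x => rfl

/-- The space of `G`-invariant symmetric multilinear forms in `n` variables, regarded as linear
forms on the tensor power. -/
def invariantSymmetricForms (n : ℕ) : Submodule K (Module.Dual K (⨂[K] _ : Fin n, V)) :=
  (tensorRep ρ n).dual.invariants ⊓ (permRep K V n).dual.invariants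

variable {ρ} in
theorem invariantSymmetricForms_tprod_rho {ℓ : Module.Dual K (⨂[K] _ : Fin n, V)}
    (hℓ : ℓ ∈ invariantSymmetricForms ρ n) (g : G) (x : Fin n → V) :
    ℓ (PiTensorProduct.tprod K fun j => ρ g (x j)) = ℓ (PiTensorProduct.tprod K x) := by
  rw [← tensorRep_tprod, mem_invariants_dual_iff.1 hℓ.1]

variable {ρ} in
theorem invariantSymmetricForms_tprod_comp {ℓ : Module.Dual K (⨂[K] _ : Fin n, V)}
    (hℓ : ℓ ∈ invariantSymmetricForms ρ n) (σ : Equiv.Perm (Fin n)) (x : Fin n → V) :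
    ℓ (PiTensorProduct.tprod K (x ∘ σ)) = ℓ (PiTensorProduct.tprod K x) := by
  rw [← mem_invariants_dual_iff.1 hℓ.2 σ.symm (PiTensorProduct.tprod K x), permRep_tprod,
    Equiv.symm_symm]

variable {ρ} in
theorem lift_mem_invariantSymmetricForms {φ : MultilinearMap K (fun _ : Fin n => V) K}
    (hρ : ∀ g x, (φ fun j => ρ g (x j)) = φ x)
    (hσ : ∀ (σ : Equiv.Perm (Fin n)) x, φ (x ∘ σ) = φ x) :
    PiTensorProduct.lift φ ∈ invariantSymmetricForms ρ n := by
  constructor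
  · refine mem_invariants_dual_iff.2 fun g => LinearMap.congr_fun (PiTensorProduct.ext
      (φ₁ := PiTensorProduct.lift φ ∘ₗ _) (MultilinearMap.ext fun x => ?_))
    simp only [LinearMap.compMultilinearMap_apply, LinearMap.comp_apply, tensorRep_tprod,
      PiTensorProduct.lift.tprod, hρ]
  · refine mem_invariants_dual_iff.2 fun π => LinearMap.congr_fun (PiTensorProduct.ext
      (φ₁ := PiTensorProduct.lift φ ∘ₗ _) (MultilinearMap.ext fun x => ?_))
    simp only [LinearMap.compMultilinearMap_apply, LinearMap.comp_apply, permRep_tprod,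
      PiTensorProduct.lift.tprod, hσ]

/-- The restriction of an invariant symmetric form to the diagonal, an invariant polynomial. -/
def restrictDiagonal (n : ℕ) : invariantSymmetricForms ρ n →ₗ[K] invariantPolynomials ρ n where
  toFun ℓ := ⟨fun x => ℓ.1 (PiTensorProduct.tprod K fun _ => x),
    ⟨ℓ.1.compMultilinearMap (PiTensorProduct.tprod K), fun _ => rfl⟩,
    fun g x => invariantSymmetricForms_tprod_rho ℓ.2 g fun _ => x⟩
  map_add' _ _ := rfl
  map_smul' _ _ := rfl

theorem restrictDiagonal_injective [CharZero K] : Function.Injective (restrictDiagonal ρ n) :=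
  fun ℓ ℓ' h => Subtype.ext <| PiTensorProduct.ext <| multilinearMap_ext_diagonal
    (invariantSymmetricForms_tprod_comp ℓ.2) (invariantSymmetricForms_tprod_comp ℓ'.2)
    fun x => congrFun (congrArg Subtype.val h) x

theorem restrictDiagonal_surjective [CharZero K] : Function.Surjective (restrictDiagonal ρ n) := by
  rintro ⟨f, ⟨φ, hφ⟩, hf⟩
  have symmetrize_rho (g : G) : (symmetrize φ).compLinearMap (fun _ => ρ g) = symmetrize φ := by
    refine multilinearMap_ext_diagonal (fun σ x => symmetrize_comp_perm φ σ fun i => ρ g (x i))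
      (symmetrize_comp_perm φ) fun x => ?_
    rw [MultilinearMap.compLinearMap_apply, symmetrize_diagonal, symmetrize_diagonal, ← hφ, ← hφ,
      hf]
  refine ⟨⟨PiTensorProduct.lift (symmetrize φ), lift_mem_invariantSymmetricForms
    (fun g => DFunLike.congr_fun (symmetrize_rho g)) (symmetrize_comp_perm φ)⟩, ?_⟩
  refine Subtype.ext (funext fun x => ?_)
  change PiTensorProduct.lift (symmetrize φ) (PiTensorProduct.tprod K fun _ => x) = f x
  rw [PiTensorProduct.lift.tprod, symmetrize_diagonal, hφ]

/-- In characteristic zero, invariant polynomials are the same as invariant symmetric forms. -/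
def invariantSymmetricFormsEquiv [CharZero K] (n : ℕ) :
    invariantSymmetricForms ρ n ≃ₗ[K] invariantPolynomials ρ n :=
  LinearEquiv.ofBijective (restrictDiagonal ρ n)
    ⟨restrictDiagonal_injective ρ, restrictDiagonal_surjective ρ⟩

theorem finite_invariantPolynomials [CharZero K] [FiniteDimensional K V] (n : ℕ) :
    Module.Finite K (invariantPolynomials ρ n) :=
  Module.Finite.equiv (invariantSymmetricFormsEquiv ρ n)

theorem permRep_asAlgebraHom_tensorRep (c : MonoidAlgebra K G) (π : Equiv.Perm (Fin n))
    (x : ⨂[K] _ : Fin n, V) : permRep K V n π ((tensorRep ρ n).asAlgebraHom c x) =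
      (tensorRep ρ n).asAlgebraHom c (permRep K V n π x) :=
  map_asAlgebraHom_of_intertwiningMap
    ((permRep K V n π).intertwiningMap_of_isIntertwiningMap (tensorRep ρ n) (tensorRep ρ n)
      fun g => (PiTensorProduct.map_reindex (R := K) (fun _ : Fin n => ρ g) π · |>.symm)) c x

theorem isProj_invariantSymmetricForms {c : MonoidAlgebra K G}
    [Invertible (Fintype.card (Equiv.Perm (Fin n)) : K)]
    (h : IsReynolds (tensorRep ρ n) c) :
    LinearMap.IsProj (invariantSymmetricForms ρ n)
      (Module.Dual.transpose (R := K) ((tensorRep ρ n).asAlgebraHom c) ∘ₗ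
        (permRep K V n).dual.averageMap) := by
  let f : Representation.IntertwiningMap (permRep K V n).dual (permRep K V n).dual :=
    LinearMap.intertwiningMap_of_isIntertwiningMap _ _
      (Module.Dual.transpose (R := K) ((tensorRep ρ n).asAlgebraHom c))
      fun π ℓ => LinearMap.ext fun x => congrArg ℓ (permRep_asAlgebraHom_tensorRep ρ c π⁻¹ x)
  exact isProj_inf_comp h.isProj_dual (permRep K V n).dual.isProj_averageMap
    (map_asAlgebraHom_of_intertwiningMap f _)

end tensor

open scoped TensorProduct

theorem map_averageMap {F M N : Type*} [Group F] [Fintype F] [Invertible (Fintype.card F : K)]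
    [AddCommGroup M] [Module K M] [AddCommGroup N] [Module K N] (τ : Representation K F M)
    (L : (M →ₗ[K] M) →ₗ[K] N) :
    L τ.averageMap = (Fintype.card F : K)⁻¹ • ∑ g, L (τ g) := by
  simp [Representation.averageMap, GroupAlgebra.average]

theorem finrank_invariantPolynomials [CharZero K] {G : Type v} [Group G] {V : Type*}
    [AddCommGroup V] [Module K V] [FiniteDimensional K V] (ρ : Representation K G V) {r : ℕ}
    {c : MonoidAlgebra K G} (h : IsReynolds (tensorRep ρ r) c) :
    (Module.finrank K (invariantPolynomials ρ r) : K) =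
      averageTraceEval ρ c (completeHomogeneousPoly K r) := by
  let : Invertible (Fintype.card (Equiv.Perm (Fin r)) : K) :=
    invertibleOfNonzero (Nat.cast_ne_zero.2 Fintype.card_ne_zero)
  let E := (tensorRep ρ r).asAlgebraHom c
  have trace_eq (σ : Equiv.Perm (Fin r)) :
      LinearMap.trace K _ (Module.Dual.transpose (R := K) E ∘ₗ (permRep K V r).dual σ) =
        averageTraceEval ρ c (cycleMonomial K σ⁻¹) := by
    rw [← trace_permRep_comp_asAlgebraHom]
    exact LinearMap.trace_transpose' (permRep K V r σ⁻¹ ∘ₗ E)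
  have (p : Submodule K (Module.Dual K (⨂[K] _ : Fin r, V))) : Module.Free K p :=
    Module.Free.of_divisionRing K p
  rw [← (invariantSymmetricFormsEquiv ρ r).finrank_eq,
    ← (isProj_invariantSymmetricForms ρ h).trace]
  refine (map_averageMap (permRep K V r).dual (LinearMap.trace K _ ∘ₗ
    LinearMap.llcomp K _ _ _ (Module.Dual.transpose (R := K) E))).trans ?_
  simp only [LinearMap.comp_apply, LinearMap.llcomp_apply', trace_eq]
  rw [completeHomogeneousPoly, map_smul, map_sum, Fintype.card_perm, Fintype.card_fin]
  exact congrArg _ (Equiv.sum_comp (Equiv.inv _) fun σ => averageTraceEval ρ c (cycleMonomial K σ))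

section functor

variable {G : Type v} [Group G] {V : Type u} [AddCommGroup V] [Module K V] [FiniteDimensional K V]
  {ρ : Representation K G V} {k : ℕ} {P : FGModuleCat.{u} K ⥤ FGModuleCat.{u} K}

theorem averageTraceEval_plethysmPoly_characterPoly [CharZero K] (ρ : Representation K G V)
    (hP : IsHomogeneousPolynomialFunctor k P) (c : MonoidAlgebra K G) (p : MvPolynomial ℕ+ K) :
    averageTraceEval ρ c (plethysmPoly p (characterPoly hP)) =
      averageTraceEval (functorRep P ρ) c p := by
  simp only [averageTraceEval_apply, traceEval_plethysmPoly_characterPoly]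
  rfl

theorem isRational_tensorRep [AffineAlgebraicGroup K G] (hρ : IsRational ρ) (n : ℕ) :
    IsRational (tensorRep ρ n) :=
  IsRegularMap.isRational <|
    hρ.isRegularMap.multilinear (PiTensorProduct.mapMultilinear K (fun _ => V) fun _ => V)

theorem isRational_functorRep [AffineAlgebraicGroup K G] (hρ : IsRational ρ)
    (hP : IsHomogeneousPolynomialFunctor k P) : IsRational (functorRep P ρ) := by
  obtain ⟨φ, hφ⟩ := hP V V
  refine IsRegularMap.isRational fun ψ => ?_
  have h := hρ.isRegularMap.multilinear φ ψ
  simp only [← hφ] at h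
  exact h

theorem finrank_invariantPolynomials_functorRep [CharZero K] [AffineAlgebraicGroup K G]
    (hG : IsReductive K G) (hρ : IsRational ρ) (hP : IsHomogeneousPolynomialFunctor k P) (r : ℕ) :
    (Module.finrank K (invariantPolynomials (functorRep P ρ) r) : K) =
      hallInner (plethysm (completeHomogeneous K r) (character P))
        (tensorInvariantCharacter ρ (r * k)) := by
  obtain ⟨c, hc⟩ := hG.exists_isReynolds <|
    (isRational_tensorRep hρ (r * k)).prod (isRational_tensorRep (isRational_functorRep hρ hP) r)
  have hc_tensor : IsReynolds (tensorRep ρ (r * k)) c :=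
    hc.of_intertwiningMap_surjective (Representation.IntertwiningMap.fst K _ _) Prod.fst_surjective
  have hc_functor : IsReynolds (tensorRep (functorRep P ρ) r) c :=
    hc.of_intertwiningMap_surjective (Representation.IntertwiningMap.snd K _ _) Prod.snd_surjective
  rw [finrank_invariantPolynomials (functorRep P ρ) hc_functor,
    ← averageTraceEval_plethysmPoly_characterPoly ρ hP,
    plethysm_completeHomogeneous_character hP, tensorInvariantCharacter, frobeniusCharacter]
  simp only [trace_tensorInvariants ρ hc_tensor]
  exact (hallInner_aeval_sum_cyclePowerSum (isWeightedHomogeneous_plethysmPoly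
    (isWeightedHomogeneous_completeHomogeneousPoly r) (isWeightedHomogeneous_characterPoly hP))
    (averageTraceEval ρ c)).symm

end functor

end TensorInvariants

end

open TensorInvariants in
theorem mainTheorem3 {K : Type u} [Field K] [CharZero K]
    {G : Type v} [Group G] [AffineAlgebraicGroup K G] (hG : IsReductive K G)
    {V : Type u} [AddCommGroup V] [Module K V] [FiniteDimensional K V]
    (ρ : Representation K G V) (hρ : IsRational ρ)
    (k : ℕ) (P : CategoryTheory.Functor (FGModuleCat.{u} K) (FGModuleCat.{u} K))
    (hP : IsHomogeneousPolynomialFunctor k P) :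
    (∃! F : SymFun K, IsCharacter P F) ∧
    (∀ r : ℕ, Module.Finite K (invariantPolynomials (functorRep P ρ) r) ∧
      (Module.finrank K (invariantPolynomials (functorRep P ρ) r) : K) =
        hallInner (plethysm (completeHomogeneous K r) (character P))
          (tensorInvariantCharacter ρ (r * k))) ∧
    (hilbertSeries (functorRep P ρ)).map (Nat.castRingHom K) =
      PowerSeries.mk fun r => hallInner (plethysm (completeHomogeneous K r) (character P))
        (tensorInvariantCharacter ρ (r * k)) := by
  refine ⟨existsUnique_isCharacter hP, fun r => ⟨finite_invariantPolynomials _ r,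
    finrank_invariantPolynomials_functorRep hG hρ hP r⟩, ?_⟩
  ext r
  rw [PowerSeries.coeff_map, hilbertSeries, PowerSeries.coeff_mk, PowerSeries.coeff_mk]
  exact finrank_invariantPolynomials_functorRep hG hρ hP r
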